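/- There is a polynomial-time algorithm that, given an instance of \textsc{Multicolored Clique} with parameter $k$ (an undirected simple graph $G$ and a partition of $V(G)$ into $k$ sets $V_1,\dots,V_k$ of $N$ vertices each; the question is whether $G$ has a clique $C$ with $|C\cap V_i|=1$ for all $i\in\{1,\dots,k\}$), outputs an equivalent instance of \textsc{Circulating Orientation} (an undirected graph $H$, possibly with parallel edges but without loops, and a capacity function $c\colon E(H)\to\mathbb{Z}_{\ge 0}$; the question is whether the edges of $H$ can be oriented such that for each vertex $v$ the total capacity of the edges oriented into $v$ equals the total capacity of the edges oriented out of $v$), such that $H$ is planar, $H$ has pathwidth $\mathcal{O}(k)$, and all capacities $c(e)$ are bounded by a polynomial in $|V(G)|$. Here the two instances are equivalent if the answer to the one is yes if and only if the answer to the other is yes, and the constant in $\mathcal{O}(k)$ and the polynomial are absolute, i.e. do not depend on the instance. -/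

import Mathlib

open Finset

/-! ### Multicolored Clique -/

/-- An instance of Multicolored Clique: a simple graph on the vertices `0, …, n - 1`, together with
a partition of the vertices into `k` classes (`part v` is the class of `v`), each of which consists
of exactly `N` vertices. -/
structure MulticoloredClique where
  k : ℕ
  N : ℕ
  n : ℕ
  graph : SimpleGraph (Fin n)
  part : Fin n → Fin k
  card_part : ∀ i : Fin k, #{v : Fin n | part v = i} = N

namespace MulticoloredClique

/-- The question: is there a clique containing exactly one vertex of each class? -/
def IsYes (I : MulticoloredClique) : Prop :=
  ∃ C : Finset (Fin I.n), I.graph.IsClique (C : Set (Fin I.n)) ∧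
    ∀ i : Fin I.k, #{v ∈ C | I.part v = i} = 1

open Classical in
/-- The instance as a list of numbers: `k`, `N`, `n`, then the classes of the vertices, then the
rows of the 0/1 adjacency matrix. -/
noncomputable def encode (I : MulticoloredClique) : List ℕ :=
  [I.k, I.N, I.n] ++ List.ofFn (fun v => (I.part v : ℕ)) ++
    (List.ofFn fun u => List.ofFn fun v => if I.graph.Adj u v then 1 else 0).flatten

end MulticoloredClique

/-! ### Undirected multigraphs, planarity, pathwidth -/

/-- An undirected multigraph without loops, with vertex type `V` and edge type `E`. The edge `e`
joins `fst e` and `snd e`; the order of the two ends carries no meaning. -/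
structure Multigraph (V E : Type*) where
  fst : E → V
  snd : E → V
  loopless : ∀ e, fst e ≠ snd e

namespace Multigraph

variable {V E : Type*}

/-- A planar drawing: vertices are distinct points of the plane, every edge is a Jordan arc (an
injective path) between its end-points, no edge passes through a vertex, and distinct edges meet
only in common end-points. -/
structure PlanarDrawing (H : Multigraph V E) where
  pos : V → ℝ × ℝ
  pos_injective : Function.Injective pos
  arc : ∀ e : E, Path (pos (H.fst e)) (pos (H.snd e))
  arc_injective : ∀ e, Function.Injective (arc e)
  vertex_on_arc : ∀ e v x, arc e x = pos v → x = 0 ∨ x = 1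
  arcs_meet : ∀ e e', e ≠ e' → ∀ x y, arc e x = arc e' y → (x = 0 ∨ x = 1) ∧ (y = 0 ∨ y = 1)

def IsPlanar (H : Multigraph V E) : Prop := Nonempty H.PlanarDrawing

/-- A path decomposition, over a path with the nodes `0, …, length` in this order: every edge has
both ends in some bag, and the nodes whose bags contain a given vertex form a nonempty subpath. -/
structure PathDecomposition (H : Multigraph V E) where
  length : ℕ
  bag : Fin (length + 1) → Finset V
  edge_mem : ∀ e, ∃ i, H.fst e ∈ bag i ∧ H.snd e ∈ bag i
  vertex_mem : ∀ v, ∃ i, v ∈ bag i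
  interval : ∀ v i j l, i ≤ j → j ≤ l → v ∈ bag i → v ∈ bag l → v ∈ bag j

/-- The pathwidth: the least `w` such that some path decomposition has all bags of size at most
`w + 1`. (On a finite multigraph such a `w` exists, by a single bag containing all vertices.) -/
noncomputable def pathwidth (H : Multigraph V E) : ℕ :=
  sInf {w : ℕ | ∃ D : H.PathDecomposition, ∀ i, #(D.bag i) ≤ w + 1}

/-- The vertex into which `e` points, in the orientation `o`: the edge `e` is oriented from `fst e`
to `snd e` if `o e` is true, and from `snd e` to `fst e` otherwise. -/
def head (H : Multigraph V E) (o : E → Bool) (e : E) : V := if o e then H.snd e else H.fst e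

/-- The vertex out of which `e` points, in the orientation `o`. -/
def tail (H : Multigraph V E) (o : E → Bool) (e : E) : V := if o e then H.fst e else H.snd e

/-- In the orientation `o`, for every vertex, the total capacity of the edges oriented into it is
equal to the total capacity of the edges oriented out of it. -/
def IsCirculating [DecidableEq V] [Fintype E] (H : Multigraph V E) (c : E → ℕ) (o : E → Bool) :
    Prop :=
  ∀ v : V, ∑ e : E with H.head o e = v, c e = ∑ e : E with H.tail o e = v, c e

end Multigraph

/-! ### Circulating Orientation -/

/-- An instance of Circulating Orientation: an undirected multigraph with vertices `0, …, n - 1` and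
edges `0, …, m - 1`, together with nonnegative integral edge capacities. -/
structure CirculatingOrientation where
  n : ℕ
  m : ℕ
  graph : Multigraph (Fin n) (Fin m)
  cap : Fin m → ℕ

namespace CirculatingOrientation

/-- The question: is there a circulating orientation? -/
def IsYes (J : CirculatingOrientation) : Prop :=
  ∃ o : Fin J.m → Bool, J.graph.IsCirculating J.cap o

/-- The instance as a list of numbers: the number of vertices, followed by three numbers for each
edge, namely its two ends and its capacity. -/
def encode (J : CirculatingOrientation) : List ℕ :=
  J.n :: (List.ofFn fun e =>
    [(J.graph.fst e : ℕ), (J.graph.snd e : ℕ), J.cap e]).flatten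

end CirculatingOrientation

/-! ### Algorithms: random access machines with a step count

Programs of a random access machine, in structured form. The machine has registers and a memory,
both indexed by and holding natural numbers, and an output tape. Every operation costs one step.
Addition and truncated subtraction are the only arithmetic operations, so a run of `t` steps
produces only numbers that are at most `t` bits longer than those of its input and its program.
Hence polynomial time has its usual meaning (that of Turing machines). -/

structure RAMState where
  reg : ℕ → ℕ
  mem : ℕ → ℕ
  out : List ℕ

inductive RAMExpr where
  | const (a : ℕ)
  | reg (x : ℕ)
  | mem (e : RAMExpr)
  | add (e f : RAMExpr)
  | sub (e f : RAMExpr)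

namespace RAMExpr

/-- The value of an expression; `mem e` is the content of the memory cell with address `e`. -/
def eval (s : RAMState) : RAMExpr → ℕ
  | const a => a
  | reg x => s.reg x
  | mem e => s.mem (e.eval s)
  | add e f => e.eval s + f.eval s
  | sub e f => e.eval s - f.eval s

/-- The number of steps taken to evaluate an expression. -/
def cost : RAMExpr → ℕ
  | const _ => 1
  | reg _ => 1
  | mem e => e.cost + 1
  | add e f => e.cost + f.cost + 1
  | sub e f => e.cost + f.cost + 1

end RAMExpr

inductive RAMProgram where
  /-- do nothing -/
  | nop
  /-- register number `x` := `e` -/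
  | assign (x : ℕ) (e : RAMExpr)
  /-- memory cell number `a` := `e` -/
  | store (a e : RAMExpr)
  /-- append `e` to the output tape -/
  | write (e : RAMExpr)
  /-- first `p`, then `q` -/
  | seq (p q : RAMProgram)
  /-- if `a < b` then `p` else `q` -/
  | branch (a b : RAMExpr) (p q : RAMProgram)
  /-- while `a < b` do `p` -/
  | loop (a b : RAMExpr) (p : RAMProgram)

/-- `RAMExec p s t s'`: started in the state `s`, the program `p` halts after exactly `t` steps, in
the state `s'`. -/
inductive RAMExec : RAMProgram → RAMState → ℕ → RAMState → Prop where
  | nop (s : RAMState) : RAMExec .nop s 1 s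
  | assign (x : ℕ) (e : RAMExpr) (s : RAMState) :
      RAMExec (.assign x e) s (e.cost + 1) { s with reg := Function.update s.reg x (e.eval s) }
  | store (a e : RAMExpr) (s : RAMState) :
      RAMExec (.store a e) s (a.cost + e.cost + 1)
        { s with mem := Function.update s.mem (a.eval s) (e.eval s) }
  | write (e : RAMExpr) (s : RAMState) :
      RAMExec (.write e) s (e.cost + 1) { s with out := s.out ++ [e.eval s] }
  | seq {p q : RAMProgram} {s s' s'' : RAMState} {t t' : ℕ} :
      RAMExec p s t s' → RAMExec q s' t' s'' → RAMExec (.seq p q) s (t + t') s''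
  | branch_true {a b : RAMExpr} {p q : RAMProgram} {s s' : RAMState} {t : ℕ} :
      a.eval s < b.eval s → RAMExec p s t s' →
      RAMExec (.branch a b p q) s (a.cost + b.cost + 1 + t) s'
  | branch_false {a b : RAMExpr} {p q : RAMProgram} {s s' : RAMState} {t : ℕ} :
      ¬ a.eval s < b.eval s → RAMExec q s t s' →
      RAMExec (.branch a b p q) s (a.cost + b.cost + 1 + t) s'
  | loop_true {a b : RAMExpr} {p : RAMProgram} {s s' s'' : RAMState} {t t' : ℕ} :
      a.eval s < b.eval s → RAMExec p s t s' → RAMExec (.loop a b p) s' t' s'' →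
      RAMExec (.loop a b p) s (a.cost + b.cost + 1 + t + t') s''
  | loop_false {a b : RAMExpr} {p : RAMProgram} {s : RAMState} :
      ¬ a.eval s < b.eval s → RAMExec (.loop a b p) s (a.cost + b.cost + 1) s

/-- The initial state on a given input: the input stands at the beginning of the memory, its length
in register number 0; all else is zero, and the output tape is empty. -/
def RAMState.init (input : List ℕ) : RAMState where
  reg := Function.update (fun _ => 0) 0 input.length
  mem := fun i => input.getD i 0
  out := []

/-- The size of an input: its length in bits, each number written in binary and followed by a
separator. -/
def inputSize (input : List ℕ) : ℕ := (input.map fun a => Nat.size a + 1).sum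

/-- The map `f` is computed by an algorithm whose running time is bounded by a polynomial in the
size of the input; `encA` and `encB` say how arguments and values of `f` are written down. -/
def PolyTimeComputable {A B : Type*} (encA : A → List ℕ) (encB : B → List ℕ) (f : A → B) : Prop :=
  ∃ (P : RAMProgram) (p : Polynomial ℕ), ∀ a : A, ∃ (t : ℕ) (s : RAMState),
    RAMExec P (RAMState.init (encA a)) t s ∧ s.out = encB (f a) ∧ t ≤ p.eval (inputSize (encA a))

/-! The graph is a grid of `n * n + 2` columns with `k + 1` vertices each, in which neighbours are
joined by bundles of parallel edges. An orientation is a flow whose value on a bundle is a signed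
sum of its capacities. Row `c + 1` belongs to class `c`, and row `0` closes the circuit. With `M =
offset k n = k * n + 1`, the choice of vertex `x c` in class `c` is a flow of `64 * (2 * M + 2 * x
c)` along the row of `c`, and the total returns on row `0`.

The bundles from column `t` to column `t + 1` form segment `t`. Segment `0` lets each row start with
any value, and each of the next `n * n` segments tests one ordered pair `u`, `v`. In a test segment
a row carries, up to sign, twice the sum of some of its choice capacities. As `M > n`, the sum near
the current value has exactly one nonzero term, so the row must repeat its choice, which is a vertex
of the right class (`testCaps_decode`). If `u`, `v` are not adjacent, the capacities of these two
choices are smaller by one, so every chosen one among them lowers the flow by 2.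

The vertical bundles of inner columns are two unit edges, with flow -2, 0 or 2. A row thus changes
by at most 4 between segments, far below the distance 128 between choices. The returning row also
has two unit edges: modulo 64 it absorbs a deficit of 2, but not of 4. So a chosen non-adjacent pair
is refuted in its own segment (`exists_choice_of_flow`). Conversely, the choices from a clique are
hit at most once per segment, and the vertical flows forced by conservation are then admissible
(`signedSum_rowFlow`, `signedSum_columnFlow`). The global direction of the flow is fixed by
reversing all edges if necessary; then `M > k * n` forces all class rows against the returning row
(`rows_flow_right`).

A grid with parallel edges is planar, and numbering it column by column gives bandwidth, hence
pathwidth, at most `k + 1`. The edge list is written by nested loops, multiplication being repeated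
addition. If `n > 0` then `k ≤ n`, so time and capacities are polynomial in `n`; the case `n = 0` is
treated separately. -/

/-! ### Planarity and pathwidth of grid graphs -/

/-- A point of the arc that runs from `(0, 0)` to `(1, 0)`, with height governed by `h`. -/
noncomputable def bump (h : ℝ) (s : ℝ) : ℝ := h * (s * (1 - s))

lemma bump_nonneg {h s : ℝ} (hh : 0 ≤ h) (h0 : 0 ≤ s) (h1 : s ≤ 1) : 0 ≤ bump h s :=
  mul_nonneg hh (mul_nonneg h0 (by linarith))

/-- The factor `1 / 2` keeps a horizontal and a vertical arc from the same grid point on different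
sides of the diagonal. -/
lemma bump_le {h s : ℝ} (hh : 0 ≤ h) (hh' : h ≤ 1 / 2) (h0 : 0 ≤ s) (h1 : s ≤ 1) :
    bump h s ≤ s / 2 := by
  unfold bump
  have : s * (1 - s) ≤ s := by nlinarith
  have h2 : 0 ≤ s * (1 - s) := mul_nonneg h0 (by linarith)
  nlinarith

/-- The arc of a grid edge from `(a, b)` to its right neighbour (if `d` is true) or to its upper
neighbour (if `d` is false). -/
noncomputable def gridPoint (d : Bool) (a b : ℕ) (h s : ℝ) : ℝ × ℝ :=
  if d then (a + s, b + bump h s) else (a + bump h s, b + s)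

lemma continuous_gridPoint (d : Bool) (a b : ℕ) (h : ℝ) : Continuous (gridPoint d a b h) := by
  unfold gridPoint bump
  cases d
  · simp only [Bool.false_eq_true, if_false]
    fun_prop
  · simp only [if_true]
    fun_prop

lemma gridPoint_zero (d : Bool) (a b : ℕ) (h : ℝ) : gridPoint d a b h 0 = ((a : ℝ), (b : ℝ)) := by
  cases d <;> simp [gridPoint, bump]

lemma gridPoint_one (d : Bool) (a b : ℕ) (h : ℝ) :
    gridPoint d a b h 1 = if d then ((a : ℝ) + 1, (b : ℝ)) else ((a : ℝ), (b : ℝ) + 1) := by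
  cases d <;> simp [gridPoint, bump]

lemma gridPoint_injective (d : Bool) (a b : ℕ) (h : ℝ) :
    Function.Injective (gridPoint d a b h) := by
  intro s s' hs
  cases d <;> simp [gridPoint] at hs
  · exact hs.2
  · exact hs.1

lemma nat_eq_of_add_eq {a b : ℕ} {s t : ℝ} (h : (a : ℝ) + s = b + t) (hs : 0 ≤ s) (hs' : s < 1)
    (ht : 0 ≤ t) (ht' : t < 1) : a = b := by
  have h1 : (a : ℝ) < b + 1 := by linarith
  have h2 : (b : ℝ) < a + 1 := by linarith
  have h1' : a < b + 1 := by exact_mod_cast h1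
  have h2' : b < a + 1 := by exact_mod_cast h2
  omega

lemma bump_lt_one {h s : ℝ} (hh : 0 ≤ h) (hh' : h ≤ 1 / 2) (h0 : 0 ≤ s) (h1 : s ≤ 1) :
    bump h s < 1 := by
  have := bump_le hh hh' h0 h1
  linarith

/-- One coordinate is an integer plus `s`, hence not an integer. -/
lemma gridPoint_ne_lattice {d : Bool} {a b x y : ℕ} {h s : ℝ} (h0 : 0 < s) (h1 : s < 1) :
    gridPoint d a b h s ≠ ((x : ℝ), (y : ℝ)) := by
  have key : ∀ {p q : ℕ}, (p : ℝ) + s ≠ q := by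
    intro p q he
    have := nat_eq_of_add_eq (a := p) (b := q) (s := s) (t := 0) (by simpa using he) h0.le h1
      le_rfl one_pos
    subst this
    linarith
  intro he
  cases d <;> simp [gridPoint] at he
  · exact key he.2
  · exact key he.1

/-- Comparing fractional parts reduces to arcs in one unit cell. Arcs of the same direction then
have the same parameter, which determines the height; arcs of different directions cannot meet. -/
lemma gridPoint_meet {d d' : Bool} {a b a' b' : ℕ} {h h' s s' : ℝ}
    (hh : 0 < h) (hh' : h ≤ 1 / 2) (gh : 0 < h') (gh' : h' ≤ 1 / 2)
    (h0 : 0 < s) (h1 : s < 1) (h0' : 0 < s') (h1' : s' < 1)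
    (he : gridPoint d a b h s = gridPoint d' a' b' h' s') : h = h' := by
  have b1 := bump_nonneg hh.le h0.le h1.le
  have b2 := bump_nonneg gh.le h0'.le h1'.le
  have b3 := bump_lt_one hh.le hh' h0.le h1.le
  have b4 := bump_lt_one gh.le gh' h0'.le h1'.le
  have b5 := bump_le hh.le hh' h0.le h1.le
  have b6 := bump_le gh.le gh' h0'.le h1'.le
  have fin : ∀ {p q : ℕ} {σ τ : ℝ}, (p : ℝ) + σ = q + τ → 0 ≤ σ → σ < 1 → 0 ≤ τ → τ < 1 →
      σ = τ := by
    intro p q σ τ e e1 e2 e3 e4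
    have := nat_eq_of_add_eq e e1 e2 e3 e4
    subst this
    linarith
  have same : s = s' → bump h s = bump h' s' → h = h' := by
    rintro rfl e
    have : s * (1 - s) ≠ 0 := (mul_pos h0 (by linarith)).ne'
    exact mul_right_cancel₀ this e
  cases d <;> cases d' <;> simp [gridPoint] at he
  · exact same (fin he.2 h0.le h1 h0'.le h1') (fin he.1 b1 b3 b2 b4)
  -- Here `s' ≤ s / 2` and `s ≤ s' / 2`, impossible for positive parameters.
  · have e1 := fin he.1 b1 b3 h0'.le h1'
    have e2 := fin he.2 h0.le h1 b2 b4
    linarith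
  · have e1 := fin he.1 h0.le h1 b2 b4
    have e2 := fin he.2 b1 b3 h0'.le h1'
    linarith
  · exact same (fin he.1 h0.le h1 h0'.le h1') (fin he.2 b1 b3 b2 b4)

/-- A multigraph is planar if its vertices can be placed on distinct points of the integer grid such
that every edge joins a point to its right or upper neighbour. -/
theorem Multigraph.isPlanar_of_grid {V : Type*} {m : ℕ} (H : Multigraph V (Fin m)) (g : V → ℕ × ℕ)
    (hg : Function.Injective g)
    (he : ∀ e, g (H.snd e) = ((g (H.fst e)).1 + 1, (g (H.fst e)).2) ∨
      g (H.snd e) = ((g (H.fst e)).1, (g (H.fst e)).2 + 1)) : H.IsPlanar := by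
  classical
  let d : Fin m → Bool := fun e =>
    decide (g (H.snd e) = ((g (H.fst e)).1 + 1, (g (H.fst e)).2))
  -- Heights are pairwise distinct, so that parallel edges meet only at their ends.
  let ht : Fin m → ℝ := fun e => 1 / ((e : ℝ) + 2)
  have ht0 : ∀ e, 0 < ht e := fun e => by positivity
  have ht1 : ∀ e, ht e ≤ 1 / 2 := fun e =>
    one_div_le_one_div_of_le (by norm_num) (by linarith [Nat.cast_nonneg (α := ℝ) (e : ℕ)])
  have htinj : ∀ e e', ht e = ht e' → e = e' := by
    intro e e' h
    have h2 : ((e : ℕ) : ℝ) + 2 = ((e' : ℕ) : ℝ) + 2 := by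
      simpa [ht] using h
    exact Fin.ext (by exact_mod_cast add_right_cancel h2)
  let pos : V → ℝ × ℝ := fun v => (((g v).1 : ℝ), ((g v).2 : ℝ))
  let arc : ∀ e : Fin m, Path (pos (H.fst e)) (pos (H.snd e)) := fun e =>
    { toFun := fun x => gridPoint (d e) (g (H.fst e)).1 (g (H.fst e)).2 (ht e) x
      continuous_toFun := (continuous_gridPoint _ _ _ _).comp continuous_subtype_val
      source' := by simp [gridPoint_zero, pos]
      target' := by
        simp only [Set.Icc.coe_one, gridPoint_one, pos]
        by_cases h : g (H.snd e) = ((g (H.fst e)).1 + 1, (g (H.fst e)).2)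
        · simp [d, h]
        · have h' := (he e).resolve_left h
          simp [d, h'] }
  have harc : ∀ e x, arc e x =
      gridPoint (d e) (g (H.fst e)).1 (g (H.fst e)).2 (ht e) (x : ℝ) := fun _ _ => rfl
  have ends : ∀ x : unitInterval, ¬ (x = 0 ∨ x = 1) → (0 : ℝ) < x ∧ (x : ℝ) < 1 := by
    intro x hx
    push Not at hx
    exact ⟨unitInterval.pos_iff_ne_zero.2 hx.1, unitInterval.lt_one_iff_ne_one.2 hx.2⟩
  have voa : ∀ e v x, arc e x = pos v → x = 0 ∨ x = 1 := by
    intro e v x h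
    by_contra hx
    obtain ⟨h0, h1⟩ := ends x hx
    rw [harc] at h
    exact gridPoint_ne_lattice h0 h1 h
  have lat : ∀ e x, x = 0 ∨ x = 1 → ∃ v, arc e x = pos v := by
    rintro e x (rfl | rfl)
    · exact ⟨_, (arc e).source⟩
    · exact ⟨_, (arc e).target⟩
  refine ⟨⟨pos, ?_, arc, ?_, voa, ?_⟩⟩
  · intro v w h
    simp only [pos, Prod.mk.injEq, Nat.cast_inj] at h
    exact hg (Prod.ext h.1 h.2)
  · intro e x y h
    rw [harc, harc] at h
    exact Subtype.ext (gridPoint_injective _ _ _ _ h)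
  · intro e e' hne x y h
    by_cases hx : x = 0 ∨ x = 1
    · obtain ⟨v, hv⟩ := lat e x hx
      exact ⟨hx, voa e' v y (h ▸ hv)⟩
    by_cases hy : y = 0 ∨ y = 1
    · obtain ⟨v, hv⟩ := lat e' y hy
      exact ⟨voa e v x (h ▸ hv), hy⟩
    obtain ⟨h0, h1⟩ := ends x hx
    obtain ⟨h0', h1'⟩ := ends y hy
    rw [harc, harc] at h
    exact absurd (htinj _ _ (gridPoint_meet (ht0 e) (ht1 e) (ht0 e') (ht1 e') h0 h1 h0' h1' h)) hne

/-- The pathwidth is at most the bandwidth. -/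
theorem Multigraph.pathwidth_le_of_bandwidth {n : ℕ} {E : Type*} (H : Multigraph (Fin n) E) (w : ℕ)
    (hw : ∀ e, (H.fst e : ℕ) ≤ H.snd e + w ∧ (H.snd e : ℕ) ≤ H.fst e + w) : H.pathwidth ≤ w := by
  -- The bags are the windows `[i, i + w]`; an edge lies in the window at its smaller end. Taking `n
  -- + 1` bags provides one even if `n = 0`.
  refine Nat.sInf_le ⟨⟨n, fun i => {v : Fin n | (i : ℕ) ≤ v ∧ (v : ℕ) ≤ i + w}, ?_, ?_, ?_⟩, ?_⟩
  · intro e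
    obtain ⟨h1, h2⟩ := hw e
    have := (H.fst e).2
    refine ⟨⟨min (H.fst e) (H.snd e), by omega⟩, ?_⟩
    simp only [Finset.mem_filter_univ]
    omega
  · intro v
    exact ⟨⟨v, by omega⟩, by simp⟩
  · intro v i j l hij hjl hi hl
    simp only [Finset.mem_filter_univ] at *
    have hij' : (i : ℕ) ≤ j := hij
    have hjl' : (j : ℕ) ≤ l := hjl
    omega
  · intro i
    calc #{v : Fin n | (i : ℕ) ≤ v ∧ (v : ℕ) ≤ i + w}
        = #(({v : Fin n | (i : ℕ) ≤ v ∧ (v : ℕ) ≤ i + w} : Finset (Fin n)).map Fin.valEmbedding) :=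
          (Finset.card_map _).symm
      _ ≤ #(Finset.Icc (i : ℕ) (i + w)) := by
          apply Finset.card_le_card
          intro x hx
          simp only [Finset.mem_map, Finset.mem_filter_univ, Fin.valEmbedding_apply] at hx
          obtain ⟨v, hv, rfl⟩ := hx
          exact Finset.mem_Icc.2 hv
      _ = w + 1 := by simp; omega

/-! ### Orientations of edge lists -/

/-- `z` is a sum of the numbers of the list with suitable signs. -/
def SignedSum : List ℕ → ℤ → Prop
  | [], z => z = 0
  | c :: l, z => SignedSum l (z - c) ∨ SignedSum l (z + c)

lemma signedSum_append {l l' : List ℕ} {z : ℤ} :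
    SignedSum (l ++ l') z ↔ ∃ a b, SignedSum l a ∧ SignedSum l' b ∧ z = a + b := by
  induction l generalizing z with
  | nil => simp [SignedSum]
  | cons c l ih =>
    simp only [List.cons_append, SignedSum, ih]
    constructor
    · rintro (⟨a, b, ha, hb, h⟩ | ⟨a, b, ha, hb, h⟩)
      · exact ⟨a + c, b, .inl (by simpa using ha), hb, by omega⟩
      · exact ⟨a - c, b, .inr (by simpa using ha), hb, by omega⟩
    · rintro ⟨a, b, ha | ha, hb, h⟩
      · exact .inl ⟨_, b, ha, hb, by omega⟩
      · exact .inr ⟨_, b, ha, hb, by omega⟩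

lemma SignedSum.neg {l : List ℕ} {z : ℤ} (h : SignedSum l z) : SignedSum l (-z) := by
  induction l generalizing z with
  | nil => simpa [SignedSum] using h
  | cons c l ih =>
    rcases h with h | h
    · refine .inr ?_
      have := ih h
      rwa [show -(z - c) = -z + c by ring] at this
    · refine .inl ?_
      have := ih h
      rwa [show -(z + c) = -z - c by ring] at this

lemma signedSum_singleton {c : ℕ} {z : ℤ} : SignedSum [c] z ↔ z = c ∨ z = -c := by
  simp only [SignedSum]
  omega

lemma signedSum_one_one {z : ℤ} : SignedSum [1, 1] z ↔ z = -2 ∨ z = 0 ∨ z = 2 := by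
  simp only [SignedSum]
  push_cast
  omega

/-- Equal capacities act as a unary counter: `a` is the number of plus signs. -/
lemma signedSum_replicate {m K : ℕ} {z : ℤ} :
    SignedSum (List.replicate m K) z ↔ ∃ a : ℕ, a ≤ m ∧ z = K * (2 * a - m) := by
  induction m generalizing z with
  | zero =>
    simp only [List.replicate_zero, SignedSum]
    constructor
    · rintro rfl
      exact ⟨0, le_rfl, by simp⟩
    · rintro ⟨a, ha, rfl⟩
      obtain rfl : a = 0 := by omega
      simp
  | succ m ih =>
    simp only [List.replicate_succ, SignedSum, ih]
    constructor
    · rintro (⟨a, ha, h⟩ | ⟨a, ha, h⟩)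
      · exact ⟨a + 1, by omega, by push_cast; linear_combination h⟩
      · exact ⟨a, by omega, by push_cast; linear_combination h⟩
    · rintro ⟨a, ha, h⟩
      rcases Nat.lt_or_ge m a with h' | h'
      · obtain ⟨a, rfl⟩ : ∃ b, a = b + 1 := ⟨a - 1, by omega⟩
        exact .inl ⟨a, by omega, by push_cast at h; linear_combination h⟩
      · exact .inr ⟨a, by omega, by push_cast at h; linear_combination h⟩

/-- `F` collects the indices with a plus sign. -/
lemma signedSum_map_range {m : ℕ} {f : ℕ → ℕ} {z : ℤ} :
    SignedSum ((List.range m).map f) z ↔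
      ∃ F ⊆ range m, z = 2 * ∑ i ∈ F, (f i : ℤ) - ∑ i ∈ range m, (f i : ℤ) := by
  induction m generalizing z with
  | zero => simp [SignedSum]
  | succ m ih =>
    simp only [List.range_succ, List.map_append, List.map_cons, List.map_nil, signedSum_append, ih,
      signedSum_singleton, Finset.sum_range_succ]
    constructor
    · rintro ⟨a, b, ⟨F, hF, rfl⟩, rfl | rfl, rfl⟩
      · refine ⟨insert m F, ?_, ?_⟩
        · rw [Finset.range_add_one]
          exact Finset.insert_subset_insert _ hF
        · rw [Finset.sum_insert (fun h => by simpa using hF h)]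
          ring
      · exact ⟨F, hF.trans (Finset.range_mono (Nat.le_succ m)), by ring⟩
    · rintro ⟨F, hF, rfl⟩
      have hsub : F.erase m ⊆ range m := by
        intro x hx
        have h1 := Finset.mem_range.1 (hF (Finset.mem_of_mem_erase hx))
        have h2 := Finset.ne_of_mem_erase hx
        exact Finset.mem_range.2 (by omega)
      refine ⟨_, if m ∈ F then (f m : ℤ) else -(f m : ℤ), ⟨F.erase m, hsub, rfl⟩, ?_, ?_⟩
      · split_ifs <;> simp
      · split_ifs with h
        · rw [← Finset.add_sum_erase F _ h]
          ring
        · rw [Finset.erase_eq_of_notMem h]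
          ring

/-- The excess of a unit of flow from `a` to `b`. -/
def unitFlow (a b : ℕ) : ℕ → ℤ := Pi.single b 1 - Pi.single a 1

/-- In the list, an edge from `a` to `b` with capacity `c` is written `(a, b, c)`. The edges can be
oriented such that `φ` is the excess of incoming over outgoing capacity. -/
def Orientable : List (ℕ × ℕ × ℕ) → (ℕ → ℤ) → Prop
  | [], φ => φ = 0
  | e :: L, φ => Orientable L (φ - (e.2.2 : ℤ) • unitFlow e.1 e.2.1) ∨
      Orientable L (φ + (e.2.2 : ℤ) • unitFlow e.1 e.2.1)

lemma orientable_append {L L' : List (ℕ × ℕ × ℕ)} {φ : ℕ → ℤ} :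
    Orientable (L ++ L') φ ↔ ∃ ψ ψ', Orientable L ψ ∧ Orientable L' ψ' ∧ φ = ψ + ψ' := by
  induction L generalizing φ with
  | nil => simp [Orientable]
  | cons e L ih =>
    simp only [List.cons_append, Orientable, ih]
    constructor
    · rintro (⟨a, b, ha, hb, h⟩ | ⟨a, b, ha, hb, h⟩)
      · exact ⟨a + (e.2.2 : ℤ) • unitFlow e.1 e.2.1, b, .inl (by simpa using ha), hb, by
          rw [add_right_comm, ← h]; abel⟩
      · exact ⟨a - (e.2.2 : ℤ) • unitFlow e.1 e.2.1, b, .inr (by simpa using ha), hb, by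
          rw [sub_add_eq_add_sub, ← h]; abel⟩
    · rintro ⟨a, b, ha | ha, hb, h⟩
      · exact .inl ⟨_, b, ha, hb, by rw [h]; abel⟩
      · exact .inr ⟨_, b, ha, hb, by rw [h]; abel⟩

/-- Parallel edges from `a` to `b` with the given capacities. -/
def bundle (a b : ℕ) (l : List ℕ) : List (ℕ × ℕ × ℕ) := l.map fun c => (a, b, c)

lemma orientable_bundle {a b : ℕ} {l : List ℕ} {φ : ℕ → ℤ} :
    Orientable (bundle a b l) φ ↔ ∃ z, SignedSum l z ∧ φ = z • unitFlow a b := by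
  induction l generalizing φ with
  | nil => simp [bundle, Orientable, SignedSum]
  | cons c l ih =>
    change Orientable (bundle a b l) (φ - (c : ℤ) • unitFlow a b) ∨
      Orientable (bundle a b l) (φ + (c : ℤ) • unitFlow a b) ↔ _
    simp only [ih, SignedSum]
    constructor
    · rintro (⟨z, hz, h⟩ | ⟨z, hz, h⟩)
      · exact ⟨z + c, .inl (by simpa using hz), by rw [add_smul, ← h]; abel⟩
      · exact ⟨z - c, .inr (by simpa using hz), by rw [sub_smul, ← h]; abel⟩
    · rintro ⟨z, hz | hz, rfl⟩
      · exact .inl ⟨_, hz, by rw [sub_smul]⟩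
      · exact .inr ⟨_, hz, by rw [add_smul]⟩

lemma orientable_flatMap_range {m : ℕ} {L : ℕ → List (ℕ × ℕ × ℕ)} {φ : ℕ → ℤ} :
    Orientable ((List.range m).flatMap L) φ ↔
      ∃ Φ : ℕ → ℕ → ℤ, (∀ i < m, Orientable (L i) (Φ i)) ∧ φ = ∑ i ∈ range m, Φ i := by
  induction m generalizing φ with
  | zero => simp [Orientable]
  | succ m ih =>
    rw [List.range_succ, List.flatMap_append, orientable_append]
    simp only [ih, List.flatMap_cons, List.flatMap_nil, List.append_nil]
    constructor
    · rintro ⟨_, ψ, ⟨Φ, hΦ, rfl⟩, hψ, rfl⟩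
      refine ⟨Function.update Φ m ψ, fun i hi => ?_, ?_⟩
      · rcases Nat.lt_succ_iff_lt_or_eq.1 hi with h | rfl
        · rw [Function.update_of_ne h.ne]
          exact hΦ i h
        · rwa [Function.update_self]
      · rw [Finset.sum_range_succ, Function.update_self]
        congr 1
        refine Finset.sum_congr rfl fun i hi => ?_
        rw [Function.update_of_ne (Finset.mem_range.1 hi).ne]
    · rintro ⟨Φ, hΦ, rfl⟩
      exact ⟨_, Φ m, ⟨Φ, fun i hi => hΦ i (by omega), rfl⟩, hΦ m (by omega),
        Finset.sum_range_succ _ _⟩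

/-! ### Edge lists as instances of Circulating Orientation -/

lemma orientable_iff_exists_orientation {L : List (ℕ × ℕ × ℕ)} {φ : ℕ → ℤ} :
    Orientable L φ ↔ ∃ o : Fin L.length → Bool, φ = ∑ e : Fin L.length,
      (if o e then ((L.get e).2.2 : ℤ) else -((L.get e).2.2 : ℤ)) •
        unitFlow (L.get e).1 (L.get e).2.1 := by
  induction L generalizing φ with
  | nil => simp [Orientable]
  | cons e L ih =>
    simp only [Orientable, ih]
    constructor
    · rintro (⟨o, h⟩ | ⟨o, h⟩)
      · refine ⟨Fin.cons true o, ?_⟩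
        refine Eq.trans ?_ (Fin.sum_univ_succ _).symm
        simp only [Fin.cons_zero, Fin.cons_succ, List.get_cons_zero, List.get_cons_succ', ← h]
        simp
      · refine ⟨Fin.cons false o, ?_⟩
        refine Eq.trans ?_ (Fin.sum_univ_succ _).symm
        simp only [Fin.cons_zero, Fin.cons_succ, List.get_cons_zero, List.get_cons_succ', ← h]
        simp
    · rintro ⟨o, h⟩
      have h' := h.trans (Fin.sum_univ_succ _)
      cases h0 : o 0
      · refine .inr ⟨fun i => o i.succ, ?_⟩
        rw [h']
        simp [h0]
      · refine .inl ⟨fun i => o i.succ, ?_⟩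
        rw [h']
        simp [h0]

/-- The multigraph with the given edges. -/
def Multigraph.ofList (n : ℕ) (L : List (ℕ × ℕ × ℕ))
    (hL : ∀ e ∈ L, e.1 < n ∧ e.2.1 < n ∧ e.1 ≠ e.2.1) : Multigraph (Fin n) (Fin L.length) where
  fst := fun e => ⟨(L.get e).1, (hL _ (L.get_mem e)).1⟩
  snd := fun e => ⟨(L.get e).2.1, (hL _ (L.get_mem e)).2.1⟩
  loopless := fun e h => (hL _ (L.get_mem e)).2.2 (congrArg Fin.val h)

/-- The instance of Circulating Orientation with the given edges. -/
def CirculatingOrientation.ofList (n : ℕ) (L : List (ℕ × ℕ × ℕ))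
    (hL : ∀ e ∈ L, e.1 < n ∧ e.2.1 < n ∧ e.1 ≠ e.2.1) : CirculatingOrientation where
  n := n
  m := L.length
  graph := Multigraph.ofList n L hL
  cap := fun e => (L.get e).2.2

/-- Incoming minus outgoing capacity at a vertex is the corresponding entry of the signed sum of
unit flows. Entries beyond the vertices vanish because all ends are below `n`. -/
theorem CirculatingOrientation.isYes_ofList {n : ℕ} {L : List (ℕ × ℕ × ℕ)}
    (hL : ∀ e ∈ L, e.1 < n ∧ e.2.1 < n ∧ e.1 ≠ e.2.1) :
    (ofList n L hL).IsYes ↔ Orientable L 0 := by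
  rw [orientable_iff_exists_orientation]
  refine exists_congr fun (o : Fin L.length → Bool) => ?_
  have key : ∀ v : Fin n, (∑ e : Fin L.length,
      (if o e then ((L.get e).2.2 : ℤ) else -((L.get e).2.2 : ℤ)) •
        unitFlow (L.get e).1 (L.get e).2.1) (v : ℕ) =
      ((∑ e : Fin L.length with (Multigraph.ofList n L hL).head o e = v, (L.get e).2.2 : ℕ) : ℤ) -
      ((∑ e : Fin L.length with (Multigraph.ofList n L hL).tail o e = v, (L.get e).2.2 : ℕ) : ℤ) := by
    intro v
    rw [Finset.sum_apply, Finset.sum_filter, Finset.sum_filter]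
    push_cast
    rw [← Finset.sum_sub_distrib]
    refine Finset.sum_congr rfl fun e _ => ?_
    have h1 : (Pi.single (L.get e).1 (1 : ℤ) : ℕ → ℤ) v =
        if (⟨(L.get e).1, (hL _ (L.get_mem e)).1⟩ : Fin n) = v then 1 else 0 := by
      rw [Pi.single_apply]
      simp only [Fin.ext_iff, eq_comm]
    have h2 : (Pi.single (L.get e).2.1 (1 : ℤ) : ℕ → ℤ) v =
        if (⟨(L.get e).2.1, (hL _ (L.get_mem e)).2.1⟩ : Fin n) = v then 1 else 0 := by
      rw [Pi.single_apply]
      simp only [Fin.ext_iff, eq_comm]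
    simp only [Pi.smul_apply, unitFlow, Pi.sub_apply, h1, h2, Multigraph.head, Multigraph.tail,
      Multigraph.ofList, smul_eq_mul]
    by_cases ho : o e = true <;> simp only [ho, Bool.false_eq_true, if_false, if_true] <;>
      split_ifs <;> simp
  constructor
  · intro h
    funext v
    by_cases hv : v < n
    · have h2 := h ⟨v, hv⟩
      have h3 := key ⟨v, hv⟩
      exact (h3.trans (sub_eq_zero.2 (congrArg Nat.cast h2))).symm
    · rw [Finset.sum_apply, Pi.zero_apply]
      refine (Finset.sum_eq_zero fun e _ => ?_).symm
      obtain ⟨h1, h2, -⟩ := hL _ (L.get_mem e)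
      simp only [Pi.smul_apply, unitFlow, Pi.sub_apply]
      rw [Pi.single_eq_of_ne (by omega), Pi.single_eq_of_ne (by omega)]
      simp
  · intro h v
    have h3 := key v
    rw [← h, Pi.zero_apply] at h3
    have h4 := (sub_eq_zero.1 h3.symm)
    exact_mod_cast h4

/-! ### Grids of bundles -/

/-- The edges of a grid with `T` columns of `R` vertices each; `h t r` are the capacities of the
edges from vertex `r` of column `t` to the next column, and `v t r` those of the edges to the next
vertex of the same column. -/
def gridEdges (R T : ℕ) (h v : ℕ → ℕ → List ℕ) : List (ℕ × ℕ × ℕ) :=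
  (List.range T).flatMap fun t => (List.range R).flatMap fun r =>
    bundle (t * R + r) ((t + 1) * R + r) (h t r) ++ bundle (t * R + r) (t * R + r + 1) (v t r)

lemma grid_index_inj {R t r t' r' : ℕ} (hr : r < R) (hr' : r' < R)
    (h : t * R + r = t' * R + r') : t = t' ∧ r = r' := by
  have h1 : t = t' := by
    have := congrArg (· / R) h
    simpa [Nat.add_comm, Nat.add_mul_div_right _ _ (by omega : 0 < R), Nat.div_eq_of_lt hr,
      Nat.div_eq_of_lt hr'] using this
  subst h1
  exact ⟨rfl, by omega⟩

/-- What remains at a vertex of a grid, when `H` flows to the right and `V` flows upwards. -/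
def gridExcess (H V : ℕ → ℕ → ℤ) (t r : ℕ) : ℤ :=
  ((if t = 0 then 0 else H (t - 1) r) - H t r) + ((if r = 0 then 0 else V t (r - 1)) - V t r)

/-- Summation by parts in both directions. The hypotheses remove the terms that would leave the
grid, or wrap from the top of one column to the bottom of the next. -/
lemma sum_gridExcess_smul {R T : ℕ} {H V : ℕ → ℕ → ℤ} (hH : ∀ r, H T r = 0)
    (hV : ∀ t, V t R = 0) :
    ∑ t ∈ range (T + 1), ∑ r ∈ range (R + 1),
      (H t r • unitFlow (t * (R + 1) + r) ((t + 1) * (R + 1) + r) +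
        V t r • unitFlow (t * (R + 1) + r) (t * (R + 1) + r + 1)) =
    ∑ t ∈ range (T + 1), ∑ r ∈ range (R + 1),
      gridExcess H V t r • (Pi.single (t * (R + 1) + r) 1 : ℕ → ℤ) := by
  have h1 : ∑ t ∈ range (T + 1), ∑ r ∈ range (R + 1),
      H t r • (Pi.single ((t + 1) * (R + 1) + r) 1 : ℕ → ℤ) =
      ∑ t ∈ range (T + 1), ∑ r ∈ range (R + 1),
        (if t = 0 then 0 else H (t - 1) r) • (Pi.single (t * (R + 1) + r) 1 : ℕ → ℤ) := by
    rw [Finset.sum_range_succ _ T, Finset.sum_range_succ' _ T]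
    simp [hH]
  have h2 : ∀ t, ∑ r ∈ range (R + 1),
      V t r • (Pi.single (t * (R + 1) + r + 1) 1 : ℕ → ℤ) =
      ∑ r ∈ range (R + 1),
        (if r = 0 then 0 else V t (r - 1)) • (Pi.single (t * (R + 1) + r) 1 : ℕ → ℤ) := by
    intro t
    rw [Finset.sum_range_succ, Finset.sum_range_succ']
    simp [hV, add_assoc]
  simp only [unitFlow, gridExcess, smul_sub, add_smul, sub_smul, Finset.sum_add_distrib,
    Finset.sum_sub_distrib, h1, h2]

lemma sum_smul_single_eq_zero_iff {R T : ℕ} {B : ℕ → ℕ → ℤ} :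
    ∑ t ∈ range T, ∑ r ∈ range R, B t r • (Pi.single (t * R + r) 1 : ℕ → ℤ) = 0 ↔
      ∀ t < T, ∀ r < R, B t r = 0 := by
  constructor
  · intro h t ht r hr
    have h1 := congrFun h (t * R + r)
    simp only [Finset.sum_apply, Pi.smul_apply, Pi.zero_apply] at h1
    rw [Finset.sum_eq_single_of_mem t (Finset.mem_range.2 ht),
      Finset.sum_eq_single_of_mem r (Finset.mem_range.2 hr)] at h1
    · simpa using h1
    · intro r' hr' hne
      rw [Pi.single_eq_of_ne, smul_zero]
      intro he
      exact hne (by omega)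
    · intro t' ht' hne
      refine Finset.sum_eq_zero fun r' hr' => ?_
      rw [Pi.single_eq_of_ne, smul_zero]
      intro he
      exact hne (grid_index_inj hr (Finset.mem_range.1 hr') he).1.symm
  · intro h
    refine Finset.sum_eq_zero fun t ht => Finset.sum_eq_zero fun r hr => ?_
    rw [h t (Finset.mem_range.1 ht) r (Finset.mem_range.1 hr), zero_smul]

/-- Vertices of the grid have distinct indices, so the total vanishes exactly if the excess vanishes
at each of them. -/
theorem orientable_gridEdges {R T : ℕ} {h v : ℕ → ℕ → List ℕ} (hh : ∀ r, h T r = [])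
    (hv : ∀ t, v t R = []) :
    Orientable (gridEdges (R + 1) (T + 1) h v) 0 ↔ ∃ H V : ℕ → ℕ → ℤ,
      (∀ t ≤ T, ∀ r ≤ R, SignedSum (h t r) (H t r)) ∧
      (∀ t ≤ T, ∀ r ≤ R, SignedSum (v t r) (V t r)) ∧
      (∀ r, H T r = 0) ∧ (∀ t, V t R = 0) ∧
      ∀ t ≤ T, ∀ r ≤ R, gridExcess H V t r = 0 := by
  simp only [gridEdges, orientable_flatMap_range, orientable_append, orientable_bundle]
  constructor
  · rintro ⟨Φ, hΦ, h0⟩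
    choose! Ψ hΨ hΦΨ using hΦ
    choose! α β hα hβ hαβ using hΨ
    choose! H hH hαH using hα
    choose! V hV hβV using hβ
    -- The chosen values are arbitrary outside the grid, so the vanishing there is imposed.
    let H' : ℕ → ℕ → ℤ := fun t r => if t = T then 0 else H t r
    let V' : ℕ → ℕ → ℤ := fun t r => if r = R then 0 else V t r
    have eH : ∀ t < T + 1, ∀ r < R + 1, H t r = H' t r := by
      intro t ht r hr
      simp only [H']
      split_ifs with e
      · subst e
        have := hH t ht r hr
        rwa [hh] at this
      · rfl
    have eV : ∀ t < T + 1, ∀ r < R + 1, V t r = V' t r := by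
      intro t ht r hr
      simp only [V']
      split_ifs with e
      · subst e
        have := hV t ht r hr
        rwa [hv] at this
      · rfl
    have zH : ∀ r, H' T r = 0 := fun r => by simp [H']
    have zV : ∀ t, V' t R = 0 := fun t => by simp [V']
    refine ⟨H', V', fun t ht r hr => ?_, fun t ht r hr => ?_, zH, zV, ?_⟩
    · rw [← eH t (by omega) r (by omega)]
      exact hH t (by omega) r (by omega)
    · rw [← eV t (by omega) r (by omega)]
      exact hV t (by omega) r (by omega)
    · have key : ∑ t ∈ range (T + 1), ∑ r ∈ range (R + 1),
          gridExcess H' V' t r • (Pi.single (t * (R + 1) + r) 1 : ℕ → ℤ) = 0 := by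
        rw [← sum_gridExcess_smul zH zV, h0]
        refine Finset.sum_congr rfl fun t ht => ?_
        have ht := Finset.mem_range.1 ht
        rw [hΦΨ t ht]
        refine Finset.sum_congr rfl fun r hr => ?_
        have hr := Finset.mem_range.1 hr
        rw [hαβ t ht r hr, hαH t ht r hr, hβV t ht r hr, eH t ht r hr, eV t ht r hr]
      rw [sum_smul_single_eq_zero_iff] at key
      exact fun t ht r hr => key t (by omega) r (by omega)
  · rintro ⟨H, V, hH, hV, zH, zV, hb⟩
    refine ⟨_, fun t ht => ⟨_, fun r hr => ⟨_, _, ⟨H t r, hH t (by omega) r (by omega), rfl⟩,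
      ⟨V t r, hV t (by omega) r (by omega), rfl⟩, rfl⟩, rfl⟩, ?_⟩
    rw [sum_gridExcess_smul zH zV, eq_comm, sum_smul_single_eq_zero_iff]
    exact fun t ht r hr => hb t (by omega) r (by omega)

lemma sum_telescope (V : ℕ → ℤ) (k : ℕ) :
    ∑ r ∈ range (k + 1), ((if r = 0 then 0 else V (r - 1)) - V r) = - V k := by
  induction k with
  | zero => simp
  | succ k ih =>
    rw [Finset.sum_range_succ, ih]
    simp only [Nat.add_eq_zero_iff, one_ne_zero, and_false, if_false, Nat.add_sub_cancel]
    ring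

/-- Vertical flows cancel within a column, so conservation passes the net flow across each cut on to
the next, starting from nothing. -/
lemma sum_column_eq_zero {R T : ℕ} {H V : ℕ → ℕ → ℤ} (zV : ∀ t, V t R = 0)
    (hb : ∀ t ≤ T, ∀ r ≤ R, gridExcess H V t r = 0) {t : ℕ} (ht : t ≤ T) :
    ∑ r ∈ range (R + 1), H t r = 0 := by
  have key : ∀ t ≤ T, ∑ r ∈ range (R + 1), ((if t = 0 then 0 else H (t - 1) r) - H t r) = 0 := by
    intro t ht
    have h1 : ∑ r ∈ range (R + 1), gridExcess H V t r = 0 :=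
      Finset.sum_eq_zero fun r hr => hb t ht r (by simpa [Nat.lt_succ_iff] using hr)
    simp only [gridExcess] at h1
    rw [Finset.sum_add_distrib, sum_telescope, zV] at h1
    simpa using h1
  induction t with
  | zero => simpa using key 0 ht
  | succ t ih =>
    have := key (t + 1) ht
    simp only [Nat.add_eq_zero_iff, one_ne_zero, and_false, if_false, Nat.add_sub_cancel,
      Finset.sum_sub_distrib, ih (by omega)] at this
    omega

/-! ### Capacities of the reduction

The number `k` of classes, the number `n` of vertices, the class `p w` of a vertex `w`, and the
entries `a u v` of the adjacency matrix are given. Multiples of `64` encode a choice, in unary above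
an offset, and the remainders encode whether a non-adjacent pair is hit by the choice. -/

/-- Exceeding `n`, it makes two choices too large to pass for one; exceeding `k * n`, it lets the
offsets dominate all unary parts and so fixes directions. -/
def offset (k n : ℕ) : ℕ := k * n + 1

/-- Whether `w` is one of the vertices of the non-adjacent pair `u`, `v`. -/
def hit (a : ℕ → ℕ → ℕ) (u v w : ℕ) : ℕ := if a u v = 0 ∧ (w = u ∨ w = v) then 1 else 0

/-- Vertices of other classes keep an edge of capacity 0, which makes the bundle uniform and has no
effect. -/
def choiceCap (k n : ℕ) (p : ℕ → ℕ) (a : ℕ → ℕ → ℕ) (u v c w : ℕ) : ℕ :=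
  if p w = c then 64 * (offset k n + w) - hit a u v w else 0

/-- The row of class `c`, where the pair `u`, `v` is tested. -/
def testCaps (k n : ℕ) (p : ℕ → ℕ) (a : ℕ → ℕ → ℕ) (u v c : ℕ) : List ℕ :=
  (List.range n).map (choiceCap k n p a u v c) ++
    [∑ w ∈ range n, choiceCap k n p a u v c w]

/-- The beginning of the row of a class. -/
def startCaps (k n : ℕ) : List ℕ :=
  [64 * (2 * offset k n + n)] ++ List.replicate n 64

/-- The row on which everything returns. -/
def returnCaps (k n : ℕ) : List ℕ :=
  [64 * (k * (2 * offset k n + n))] ++ (List.replicate (k * n) 64 ++ [1, 1])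

/-- Through quotient and remainder by `n`, segments `1` to `n * n` run through all ordered pairs. -/
def rowCaps (k n : ℕ) (p : ℕ → ℕ) (a : ℕ → ℕ → ℕ) (t r : ℕ) : List ℕ :=
  if t = n * n + 1 then [] else if r = 0 then returnCaps k n else
    if t = 0 then startCaps k n else testCaps k n p a ((t - 1) / n) ((t - 1) % n) (r - 1)

/-- The number of edges is even, so that zero and all small multiples of 128 occur as signed sums:
enough to move whole choices between the rows in the outer columns. -/
def boundaryCaps (k n : ℕ) : List ℕ := List.replicate (2 * (k * (offset k n + n))) 64

def columnCaps (k n : ℕ) (t r : ℕ) : List ℕ :=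
  if r = k then [] else [1, 1] ++ if t = 0 ∨ t = n * n + 1 then boundaryCaps k n else []

def reductionEdges (k n : ℕ) (p : ℕ → ℕ) (a : ℕ → ℕ → ℕ) : List (ℕ × ℕ × ℕ) :=
  gridEdges (k + 1) (n * n + 1 + 1) (rowCaps k n p a) (columnCaps k n)

lemma hit_le_one (a : ℕ → ℕ → ℕ) (u v w : ℕ) : hit a u v w ≤ 1 := by
  unfold hit
  split_ifs <;> simp

/-! ### From a circulating orientation to a clique -/

/-- The last capacity is the total of the others: added with one sign or the other it leaves twice
the sum over the plus signs, or minus twice the sum over the minus signs. -/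
lemma signedSum_testCaps {k n : ℕ} {p : ℕ → ℕ} {a : ℕ → ℕ → ℕ} {u v c : ℕ} {z : ℤ} :
    SignedSum (testCaps k n p a u v c) z ↔ ∃ F ⊆ range n,
      z = 2 * ∑ w ∈ F, (choiceCap k n p a u v c w : ℤ) ∨
      z = -(2 * ∑ w ∈ F, (choiceCap k n p a u v c w : ℤ)) := by
  simp only [testCaps, signedSum_append, signedSum_map_range, signedSum_singleton]
  constructor
  · rintro ⟨_, _, ⟨F, hF, rfl⟩, rfl | rfl, rfl⟩
    · exact ⟨F, hF, .inl (by push_cast; ring)⟩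
    · refine ⟨range n \ F, Finset.sdiff_subset, .inr ?_⟩
      push_cast
      rw [← Finset.sum_sdiff hF]
      ring
  · rintro ⟨F, hF, rfl | rfl⟩
    · exact ⟨_, _, ⟨F, hF, rfl⟩, .inl rfl, by push_cast; ring⟩
    · refine ⟨_, _, ⟨range n \ F, Finset.sdiff_subset, rfl⟩, .inr rfl, ?_⟩
      push_cast
      rw [← Finset.sum_sdiff hF]
      ring

/-- The value lies in a window of width 40 while the encodings of choices are 128 apart, so the
window determines the choice, and the exact value reveals the hit. The case `x = n`, possible at the
start of a row, is ruled out here. -/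
lemma testCaps_decode {k n : ℕ} {p : ℕ → ℕ} {a : ℕ → ℕ → ℕ} {u v c x : ℕ} {z : ℤ} (hk : 0 < k)
    (hx : x ≤ n) (hz : SignedSum (testCaps k n p a u v c) z)
    (h1 : 64 * (2 * (offset k n : ℤ) + 2 * x) - 20 ≤ z)
    (h2 : z ≤ 64 * (2 * (offset k n : ℤ) + 2 * x) + 20) :
    x < n ∧ p x = c ∧ z = 64 * (2 * (offset k n : ℤ) + 2 * x) - 2 * hit a u v x := by
  have hM : n + 1 ≤ offset k n := by
    unfold offset
    nlinarith
  obtain ⟨F, hF, h⟩ := signedSum_testCaps.1 hz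
  have hpos : (0 : ℤ) ≤ ∑ w ∈ F, (choiceCap k n p a u v c w : ℤ) :=
    Finset.sum_nonneg fun _ _ => Nat.cast_nonneg _
  -- The window contains only positive numbers, which excludes the negative form.
  replace h : z = 2 * ∑ w ∈ F, (choiceCap k n p a u v c w : ℤ) := by
    rcases h with h | h
    · exact h
    · omega
  have hcap : ∀ w, p w = c →
      (choiceCap k n p a u v c w : ℤ) = 64 * ((offset k n : ℤ) + w) - hit a u v w := by
    intro w hw
    have := hit_le_one a u v w
    rw [choiceCap, if_pos hw, Nat.cast_sub (by omega)]
    push_cast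
    ring
  have hG : ∑ w ∈ F, (choiceCap k n p a u v c w : ℤ) =
      ∑ w ∈ F with p w = c, (choiceCap k n p a u v c w : ℤ) := by
    rw [Finset.sum_filter]
    refine Finset.sum_congr rfl fun w _ => ?_
    split_ifs with hw
    · rfl
    · simp [choiceCap, hw]
  rw [hG] at h
  have hmem : ∀ w ∈ ({w ∈ F | p w = c} : Finset ℕ), p w = c ∧ w < n := fun w hw =>
    ⟨(Finset.mem_filter.1 hw).2, Finset.mem_range.1 (hF (Finset.mem_filter.1 hw).1)⟩
  set G : Finset ℕ := {w ∈ F | p w = c}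
  have hlow : ∀ w ∈ G, 64 * (offset k n : ℤ) - 1 ≤ choiceCap k n p a u v c w := by
    intro w hw
    rw [hcap w (hmem w hw).1]
    have := hit_le_one a u v w
    omega
  -- Two choices give at least `256 * M - 4` with `M = offset k n`, above the window since `M > n`.
  have hcard : #G ≤ 1 := by
    by_contra hc
    have h3 : (#G : ℤ) * (64 * (offset k n : ℤ) - 1) ≤
        ∑ w ∈ G, (choiceCap k n p a u v c w : ℤ) := by
      rw [← nsmul_eq_mul]
      exact Finset.card_nsmul_le_sum _ _ _ hlow
    have h4 : (2 : ℤ) ≤ #G := by omega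
    have h5 : 2 * (64 * (offset k n : ℤ) - 1) ≤ (#G : ℤ) * (64 * (offset k n : ℤ) - 1) :=
      mul_le_mul_of_nonneg_right h4 (by omega)
    omega
  rcases Nat.lt_or_ge 0 (#G) with h0 | h0
  · obtain ⟨w, hw⟩ := Finset.card_eq_one.1 (le_antisymm hcard h0)
    obtain ⟨hw1, hw2⟩ := hmem w (by rw [hw]; simp)
    rw [hw, Finset.sum_singleton, hcap w hw1] at h
    have := hit_le_one a u v w
    obtain rfl : w = x := by omega
    exact ⟨hw2, hw1, by rw [h]; ring⟩
  · rw [Finset.card_eq_zero.1 (Nat.le_zero.1 h0)] at h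
    simp at h
    omega

lemma signedSum_startCaps {k n : ℕ} {z : ℤ} (hz : SignedSum (startCaps k n) z) :
    ∃ b ≤ n, z = 64 * (2 * (offset k n : ℤ) + 2 * b) ∨
      z = 64 * (-(2 * (offset k n : ℤ)) - 2 * b) := by
  simp only [startCaps, signedSum_append, signedSum_singleton, signedSum_replicate] at hz
  obtain ⟨_, _, rfl | rfl, ⟨b, hb, rfl⟩, rfl⟩ := hz
  · exact ⟨b, hb, .inl (by push_cast; ring)⟩
  · refine ⟨n - b, by omega, .inr ?_⟩
    push_cast [hb]
    ring

lemma signedSum_returnCaps {k n : ℕ} {z : ℤ} :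
    SignedSum (returnCaps k n) z ↔ ∃ (e : ℕ) (s : ℤ), e ≤ k * n ∧ (s = -2 ∨ s = 0 ∨ s = 2) ∧
      (z = 64 * (k * (2 * offset k n + n) + (2 * e - k * n)) + s ∨
        z = 64 * (-(k * (2 * offset k n + n)) + (2 * e - k * n)) + s) := by
  simp only [returnCaps, signedSum_append, signedSum_singleton, signedSum_replicate,
    signedSum_one_one]
  constructor
  · rintro ⟨_, _, h, ⟨_, s, ⟨e, he, rfl⟩, hs, rfl⟩, rfl⟩
    refine ⟨e, s, he, hs, ?_⟩
    rcases h with rfl | rfl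
    · exact .inl (by push_cast; ring)
    · exact .inr (by push_cast; ring)
  · rintro ⟨e, s, he, hs, rfl | rfl⟩
    · exact ⟨_, _, .inl rfl, ⟨_, _, ⟨e, he, rfl⟩, hs, rfl⟩, by push_cast; ring⟩
    · exact ⟨_, _, .inr rfl, ⟨_, _, ⟨e, he, rfl⟩, hs, rfl⟩, by push_cast; ring⟩

/-- If the returning row flows to the left, then all the other rows flow to the right. -/
lemma rows_flow_right {k n : ℕ} {z : ℕ → ℤ} {e : ℕ} {s : ℤ}
    (hz : ∀ c < k, SignedSum (startCaps k n) (z c)) (he : e ≤ k * n) (hs : s = -2 ∨ s = 0 ∨ s = 2)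
    (h0 : 64 * (-(k * (2 * (offset k n : ℤ) + n)) + (2 * e - k * n)) + s +
      ∑ c ∈ range k, z c = 0) :
    ∀ c < k, ∃ b ≤ n, z c = 64 * (2 * (offset k n : ℤ) + 2 * b) := by
  intro c hc
  obtain ⟨b, hb, h | h⟩ := signedSum_startCaps (hz c hc)
  · exact ⟨b, hb, h⟩
  -- With `M = offset k n`, the returning row requires a total of at least `128 * k * M - 2`. A row
  -- flowing to the left loses `256 * M` against this, while the others gain at most `128 * (k - 1)
  -- * n`.
  exfalso
  have hup : ∀ c' ∈ (range k).erase c, z c' ≤ 64 * (2 * (offset k n : ℤ) + 2 * n) := by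
    intro c' hc'
    obtain ⟨b', hb', h' | h'⟩ := signedSum_startCaps
      (hz c' (Finset.mem_range.1 (Finset.mem_of_mem_erase hc')))
    · rw [h']
      omega
    · rw [h']
      omega
  have h1 : ∑ c' ∈ (range k).erase c, z c' ≤ _ := Finset.sum_le_card_nsmul _ _ _ hup
  rw [Finset.card_erase_of_mem (Finset.mem_range.2 hc), Finset.card_range, nsmul_eq_mul,
    Nat.cast_sub (by omega)] at h1
  have h2 := Finset.add_sum_erase (range k) z (Finset.mem_range.2 hc)
  have hM : (offset k n : ℤ) = k * n + 1 := by simp [offset]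
  have he' : (e : ℤ) ≤ k * n := by exact_mod_cast he
  have h3 : (0 : ℤ) ≤ (k : ℤ) * n := by positivity
  push_cast at h1
  have h4 : s ≤ 2 := by omega
  have h5 : (0 : ℤ) ≤ n := Nat.cast_nonneg _
  have h6 : (0 : ℤ) ≤ b := Nat.cast_nonneg _
  linarith

lemma signedSum_columnCaps_inner {k n t r : ℕ} {z : ℤ} (h0 : t ≠ 0) (h1 : t ≠ n * n + 1)
    (hz : SignedSum (columnCaps k n t r) z) : -2 ≤ z ∧ z ≤ 2 := by
  simp only [columnCaps, h0, h1, or_self, if_false, List.append_nil] at hz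
  split_ifs at hz
  · simp only [SignedSum] at hz
    omega
  · rw [signedSum_one_one] at hz
    omega

/-- Choices in distinct classes are distinct, so exactly the two classes of the pair are hit. -/
lemma sum_hit_of_pair {k : ℕ} {a : ℕ → ℕ → ℕ} {x : ℕ → ℕ}
    (hx : ∀ c < k, ∀ c' < k, x c = x c' → c = c') {c c' : ℕ} (hc : c < k) (hc' : c' < k)
    (hne : c ≠ c') (h0 : a (x c) (x c') = 0) :
    ∑ d ∈ range k, hit a (x c) (x c') (x d) = 2 := by
  unfold hit
  rw [← Finset.card_filter]
  have : ({d ∈ range k | a (x c) (x c') = 0 ∧ (x d = x c ∨ x d = x c')} : Finset ℕ) = {c, c'} := by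
    ext d
    simp only [Finset.mem_filter, Finset.mem_range, h0, true_and, Finset.mem_insert,
      Finset.mem_singleton]
    constructor
    · rintro ⟨hd, h | h⟩
      · exact .inl (hx _ hd _ hc h)
      · exact .inr (hx _ hd _ hc' h)
    · rintro (rfl | rfl)
      · exact ⟨hc, .inl rfl⟩
      · exact ⟨hc', .inr rfl⟩
  rw [this, Finset.card_pair hne]

/-- The choices are read off at the start of the rows, shown to persist through all segments, and
refuted modulo 64 in the segment of a non-adjacent pair. -/
lemma exists_choice_of_flow {k n : ℕ} {p : ℕ → ℕ} {a : ℕ → ℕ → ℕ} (hk : 0 < k) (hn : 0 < n)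
    {H V : ℕ → ℕ → ℤ}
    (hH : ∀ t ≤ n * n + 1, ∀ r ≤ k, SignedSum (rowCaps k n p a t r) (H t r))
    (hV : ∀ t ≤ n * n + 1, ∀ r ≤ k, SignedSum (columnCaps k n t r) (V t r))
    (zV : ∀ t, V t k = 0)
    (hb : ∀ t ≤ n * n + 1, ∀ r ≤ k, gridExcess H V t r = 0)
    (hleft : ∃ (e : ℕ) (s : ℤ), e ≤ k * n ∧ (s = -2 ∨ s = 0 ∨ s = 2) ∧
      H 0 0 = 64 * (-(k * (2 * offset k n + n)) + (2 * e - k * n)) + s) :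
    ∃ x : ℕ → ℕ, (∀ c < k, x c < n ∧ p (x c) = c) ∧
      ∀ c < k, ∀ c' < k, c ≠ c' → a (x c) (x c') ≠ 0 := by
  have hcut : ∀ t ≤ n * n + 1, H t 0 + ∑ c ∈ range k, H t (c + 1) = 0 := by
    intro t ht
    have := sum_column_eq_zero zV hb ht
    rw [Finset.sum_range_succ'] at this
    omega
  obtain ⟨e, s, he, hs, h00⟩ := hleft
  have hstart : ∀ c < k, ∃ b ≤ n, H 0 (c + 1) = 64 * (2 * (offset k n : ℤ) + 2 * b) := by
    refine rows_flow_right (fun c hc => ?_) he hs (by rw [← h00]; exact hcut 0 (by omega))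
    have := hH 0 (by omega) (c + 1) (by omega)
    simpa [rowCaps] using this
  choose! x hxn hx using hstart
  have htest : ∀ t < n * n, ∀ c < k,
      SignedSum (testCaps k n p a (t / n) (t % n) c) (H (t + 1) (c + 1)) := by
    intro t ht c hc
    have := hH (t + 1) (by omega) (c + 1) (by omega)
    simpa [rowCaps, ht.ne] using this
  have hstep : ∀ t < n * n, ∀ c < k, H t (c + 1) - 4 ≤ H (t + 1) (c + 1) ∧
      H (t + 1) (c + 1) ≤ H t (c + 1) + 4 := by
    intro t ht c hc
    have h1 := hb (t + 1) (by omega) (c + 1) (by omega)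
    have h2 := signedSum_columnCaps_inner (by omega) (by omega)
      (hV (t + 1) (by omega) (c + 1) (by omega))
    have h3 := signedSum_columnCaps_inner (by omega) (by omega)
      (hV (t + 1) (by omega) c (by omega))
    simp only [gridExcess, Nat.add_eq_zero_iff, one_ne_zero, and_false, if_false,
      Nat.add_sub_cancel] at h1
    omega
  -- Errors do not accumulate: a deviation of at most 2 grows to at most 6 in a column, and decoding
  -- brings it back to at most 2.
  have hnear : ∀ t ≤ n * n, ∀ c < k, 64 * (2 * (offset k n : ℤ) + 2 * x c) - 2 ≤ H t (c + 1) ∧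
      H t (c + 1) ≤ 64 * (2 * (offset k n : ℤ) + 2 * x c) + 2 := by
    intro t
    induction t with
    | zero =>
      intro _ c hc
      rw [hx c hc]
      omega
    | succ t ih =>
      intro ht c hc
      have h1 := ih (by omega) c hc
      have h2 := hstep t (by omega) c hc
      have h3 := (testCaps_decode hk (hxn c hc) (htest t (by omega) c hc)
        (by omega) (by omega)).2.2
      have := hit_le_one a (t / n) (t % n) (x c)
      omega
  have hdec : ∀ t < n * n, ∀ c < k, x c < n ∧ p (x c) = c ∧
      H (t + 1) (c + 1) = 64 * (2 * (offset k n : ℤ) + 2 * x c) - 2 * hit a (t / n) (t % n) (x c) := by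
    intro t ht c hc
    have h1 := hnear (t + 1) (by omega) c hc
    exact testCaps_decode hk (hxn c hc) (htest t ht c hc) (by omega) (by omega)
  have hnn : 0 < n * n := Nat.mul_pos hn hn
  refine ⟨x, fun c hc => ⟨(hdec 0 hnn c hc).1, (hdec 0 hnn c hc).2.1⟩, ?_⟩
  intro c hc c' hc' hne h0
  have hu := (hdec 0 hnn c hc).1
  have hv := (hdec 0 hnn c' hc').1
  have hinj : ∀ c < k, ∀ c' < k, x c = x c' → c = c' := by
    intro c hc c' hc' h
    rw [← (hdec 0 hnn c hc).2.1, ← (hdec 0 hnn c' hc').2.1, h]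
  have ht : x c * n + x c' < n * n := by nlinarith
  have hdiv : (x c * n + x c') / n = x c := by
    rw [Nat.add_comm, Nat.add_mul_div_right _ _ hn, Nat.div_eq_of_lt hv, Nat.zero_add]
  have hmod : (x c * n + x c') % n = x c' := by
    rw [Nat.add_comm, Nat.add_mul_mod_self_right, Nat.mod_eq_of_lt hv]
  have hsum := sum_hit_of_pair hinj hc hc' hne h0
  have h1 := hcut (x c * n + x c' + 1) (by omega)
  have h2 : ∑ d ∈ range k, H (x c * n + x c' + 1) (d + 1) =
      64 * ∑ d ∈ range k, (2 * (offset k n : ℤ) + 2 * x d) - 2 * 2 := by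
    have hsum' : ∑ d ∈ range k, (hit a (x c) (x c') (x d) : ℤ) = 2 := by exact_mod_cast hsum
    rw [Finset.sum_congr rfl fun d hd => (hdec _ ht d (Finset.mem_range.1 hd)).2.2, hdiv, hmod,
      Finset.sum_sub_distrib, ← Finset.mul_sum, ← Finset.mul_sum, hsum']
  have h3 := hH (x c * n + x c' + 1) (by omega) 0 (by omega)
  rw [rowCaps, if_neg (by omega), if_pos rfl, signedSum_returnCaps] at h3
  obtain ⟨e', s', -, hs', h3⟩ := h3
  -- Modulo 64 the class rows carry -4 and the returning row carries -2, 0 or 2, yet they must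
  -- cancel.
  omega

/-! ### From a clique to a circulating orientation -/

section Completeness

variable {k n : ℕ} {p : ℕ → ℕ} {a : ℕ → ℕ → ℕ} {x : ℕ → ℕ}

/-- The number of vertices hit in segment `t` by the choice of class `c`. -/
def segmentHit (n : ℕ) (a : ℕ → ℕ → ℕ) (x : ℕ → ℕ) (t c : ℕ) : ℕ :=
  if t = 0 then 0 else hit a ((t - 1) / n) ((t - 1) % n) (x c)

/-- The flow on the row of class `c` in segment `t`. -/
def choiceFlow (k n : ℕ) (a : ℕ → ℕ → ℕ) (x : ℕ → ℕ) (t c : ℕ) : ℤ :=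
  64 * (2 * offset k n + 2 * x c) - 2 * segmentHit n a x t c

def rowFlow (k n : ℕ) (a : ℕ → ℕ → ℕ) (x : ℕ → ℕ) (t r : ℕ) : ℤ :=
  if t = n * n + 1 then 0 else
    if r = 0 then -∑ c ∈ range k, choiceFlow k n a x t c else choiceFlow k n a x t (r - 1)

/-- Conservation from the bottom of the column upwards leaves no other value. -/
def columnFlow (k n : ℕ) (a : ℕ → ℕ → ℕ) (x : ℕ → ℕ) (t r : ℕ) : ℤ :=
  ∑ r' ∈ range (r + 1),
    ((if t = 0 then 0 else rowFlow k n a x (t - 1) r') - rowFlow k n a x t r')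

lemma gridExcess_flow (t r : ℕ) :
    gridExcess (rowFlow k n a x) (columnFlow k n a x) t r = 0 := by
  unfold gridExcess columnFlow
  cases r with
  | zero => simp
  | succ r =>
    rw [Finset.sum_range_succ _ (r + 1)]
    simp

lemma sum_rowFlow (t : ℕ) : ∑ r ∈ range (k + 1), rowFlow k n a x t r = 0 := by
  rw [Finset.sum_range_succ']
  by_cases h : t = n * n + 1 <;> simp [rowFlow, h]

lemma columnFlow_last (t : ℕ) : columnFlow k n a x t k = 0 := by
  unfold columnFlow
  rw [Finset.sum_sub_distrib, sum_rowFlow]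
  split_ifs
  · simp
  · simp [sum_rowFlow]

/-- Summing from the top instead of the bottom avoids the returning row, so only hits of class rows
need to be counted. -/
lemma columnFlow_eq {t r : ℕ} (hr : r ≤ k) : columnFlow k n a x t r =
    -∑ c ∈ Ico r k, ((if t = 0 then 0 else rowFlow k n a x (t - 1) (c + 1)) -
      rowFlow k n a x t (c + 1)) := by
  have h1 := columnFlow_last (k := k) (n := n) (a := a) (x := x) t
  unfold columnFlow at h1 ⊢
  rw [← Finset.sum_range_add_sum_Ico _ (by omega : r + 1 ≤ k + 1), ← Finset.sum_Ico_add'] at h1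
  omega

/-- Two classes hit by a non-adjacent pair would have chosen either the same vertex or the two
vertices of that pair. -/
lemma sum_hit_le_one (hpx : ∀ c < k, x c < n ∧ p (x c) = c)
    (hadj : ∀ c < k, ∀ c' < k, c ≠ c' → a (x c) (x c') ≠ 0) {S : Finset ℕ} (hS : S ⊆ range k)
    (u v : ℕ) : ∑ c ∈ S, hit a u v (x c) ≤ 1 := by
  unfold hit
  rw [← Finset.card_filter, Finset.card_le_one]
  intro c hc c' hc'
  simp only [Finset.mem_filter] at hc hc'
  have h1 := Finset.mem_range.1 (hS hc.1)
  have h2 := Finset.mem_range.1 (hS hc'.1)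
  by_contra hne
  have hne' : x c ≠ x c' := by
    intro h
    apply hne
    rw [← (hpx c h1).2, ← (hpx c' h2).2, h]
  have h3 := hadj c h1 c' h2 hne
  have h4 := hadj c' h2 c h1 (Ne.symm hne)
  rcases hc.2.2 with e | e <;> rcases hc'.2.2 with e' | e'
  · exact hne' (e.trans e'.symm)
  · rw [e, e'] at h3
    exact h3 hc.2.1
  · rw [e, e'] at h4
    exact h4 hc.2.1
  · exact hne' (e.trans e'.symm)

lemma sum_segmentHit_le_one (hpx : ∀ c < k, x c < n ∧ p (x c) = c)
    (hadj : ∀ c < k, ∀ c' < k, c ≠ c' → a (x c) (x c') ≠ 0) {S : Finset ℕ} (hS : S ⊆ range k)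
    (t : ℕ) : ∑ c ∈ S, segmentHit n a x t c ≤ 1 := by
  unfold segmentHit
  split_ifs
  · simp
  · exact sum_hit_le_one hpx hadj hS _ _

lemma sum_choiceFlow (S : Finset ℕ) (t : ℕ) : ∑ c ∈ S, choiceFlow k n a x t c =
    64 * (2 * ∑ c ∈ S, (offset k n + x c) : ℕ) - 2 * (∑ c ∈ S, segmentHit n a x t c : ℕ) := by
  have h : ∑ c ∈ S, (2 * (offset k n : ℤ) + 2 * x c) = 2 * ∑ c ∈ S, ((offset k n : ℤ) + x c) := by
    rw [Finset.mul_sum]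
    exact Finset.sum_congr rfl fun c _ => by ring
  unfold choiceFlow
  rw [Finset.sum_sub_distrib, ← Finset.mul_sum, ← Finset.mul_sum, h]
  push_cast
  rfl

lemma signedSum_boundaryCaps {y : ℕ} (hy : y ≤ k * (offset k n + n)) :
    SignedSum (boundaryCaps k n) (64 * (2 * y : ℕ)) := by
  rw [boundaryCaps, signedSum_replicate]
  -- Half of the edges plus `y` more are oriented forwards.
  exact ⟨k * (offset k n + n) + y, by omega, by push_cast; ring⟩

lemma sum_offset_le (hpx : ∀ c < k, x c < n ∧ p (x c) = c) {S : Finset ℕ} (hS : S ⊆ range k) :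
    ∑ c ∈ S, (offset k n + x c) ≤ k * (offset k n + n) := by
  refine (Finset.sum_le_sum_of_subset hS).trans ?_
  refine (Finset.sum_le_card_nsmul _ _ (offset k n + n) fun c hc => ?_).trans (by simp)
  have := (hpx c (Finset.mem_range.1 hc)).1
  omega

lemma signedSum_rowFlow (hpx : ∀ c < k, x c < n ∧ p (x c) = c)
    (hadj : ∀ c < k, ∀ c' < k, c ≠ c' → a (x c) (x c') ≠ 0) {t r : ℕ} (hr : r ≤ k) :
    SignedSum (rowCaps k n p a t r) (rowFlow k n a x t r) := by
  unfold rowCaps rowFlow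
  split_ifs with h1 h2 h3
  · simp [SignedSum]
  · rw [signedSum_returnCaps, sum_choiceFlow]
    have h4 := sum_segmentHit_le_one hpx hadj (Finset.Subset.refl (range k)) t
    have h5 : ∑ c ∈ range k, x c ≤ k * n := by
      refine (Finset.sum_le_card_nsmul _ _ n fun c hc => ?_).trans (by simp)
      exact (hpx c (Finset.mem_range.1 hc)).1.le
    -- Flowing to the left, the unary part of the returning row counts the complement of the sum of
    -- the choices.
    refine ⟨k * n - ∑ c ∈ range k, x c, 2 * (∑ c ∈ range k, segmentHit n a x t c : ℕ), by omega,
      by omega, .inr ?_⟩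
    rw [Nat.cast_sub h5, Finset.sum_add_distrib]
    simp only [Finset.sum_const, Finset.card_range, smul_eq_mul]
    push_cast
    ring
  · have h4 := (hpx (r - 1) (by omega)).1
    rw [startCaps, signedSum_append]
    refine ⟨64 * (2 * offset k n + n), 64 * (2 * x (r - 1) - n), ?_, ?_, ?_⟩
    · rw [signedSum_singleton]
      push_cast
      exact .inl rfl
    · rw [signedSum_replicate]
      exact ⟨x (r - 1), h4.le, by push_cast; rfl⟩
    · simp only [choiceFlow, segmentHit, h3, if_true]
      push_cast
      ring
  · obtain ⟨h4, h5⟩ := hpx (r - 1) (by omega)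
    rw [signedSum_testCaps]
    refine ⟨{x (r - 1)}, by simpa using h4, .inl ?_⟩
    have h6 := hit_le_one a ((t - 1) / n) ((t - 1) % n) (x (r - 1))
    have h7 : 0 < offset k n := Nat.succ_pos _
    rw [Finset.sum_singleton, choiceCap, if_pos h5, Nat.cast_sub (by omega), choiceFlow,
      segmentHit, if_neg h3]
    push_cast
    ring

lemma signedSum_columnFlow (hpx : ∀ c < k, x c < n ∧ p (x c) = c)
    (hadj : ∀ c < k, ∀ c' < k, c ≠ c' → a (x c) (x c') ≠ 0) {t r : ℕ} (ht : t ≤ n * n + 1)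
    (hr : r ≤ k) : SignedSum (columnCaps k n t r) (columnFlow k n a x t r) := by
  unfold columnCaps
  by_cases hrk : r = k
  · subst hrk
    rw [columnFlow_last]
    simp [SignedSum]
  have hS : Ico r k ⊆ range k := by
    intro c hc
    exact Finset.mem_range.2 (Finset.mem_Ico.1 hc).2
  have hoff := sum_offset_le hpx hS
  rw [if_neg hrk, columnFlow_eq hr, signedSum_append]
  by_cases h0 : t = 0
  · subst h0
    refine ⟨0, _, by simp [signedSum_one_one], ?_, (zero_add _).symm⟩
    have h1 : ¬ 0 = n * n + 1 := by omega
    simp only [rowFlow, true_or, if_true, zero_sub, Finset.sum_neg_distrib, neg_neg, h1,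
      Nat.add_eq_zero_iff, one_ne_zero, and_false, if_false, Nat.add_sub_cancel]
    rw [sum_choiceFlow]
    simpa [segmentHit] using signedSum_boundaryCaps hoff
  have hc1 := sum_segmentHit_le_one hpx hadj hS (t - 1)
  by_cases h1 : t = n * n + 1
  · refine ⟨2 * (∑ c ∈ Ico r k, segmentHit n a x (t - 1) c : ℕ),
      -(64 * (2 * ∑ c ∈ Ico r k, (offset k n + x c) : ℕ)), ?_, ?_, ?_⟩
    · rw [signedSum_one_one]
      omega
    · rw [if_pos (.inr h1)]
      exact (signedSum_boundaryCaps hoff).neg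
    · have h2 : ¬ n * n = n * n + 1 := by omega
      simp only [rowFlow, h2, if_false, Nat.add_eq_zero_iff, one_ne_zero, and_false,
        Nat.add_sub_cancel, h1, if_true, sub_zero]
      rw [sum_choiceFlow]
      ring
  · have hc2 := sum_segmentHit_le_one hpx hadj hS t
    have h2 : t - 1 ≠ n * n + 1 := by omega
    refine ⟨_, 0, ?_, by simp [h0, h1, SignedSum], (add_zero _).symm⟩
    simp only [rowFlow, h0, h1, h2, if_false, Nat.add_eq_zero_iff, one_ne_zero, and_false,
        Nat.add_sub_cancel]
    -- Multiples of 64 cancel between consecutive segments; twice a difference of two numbers in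
    -- `{0, 1}` remains.
    rw [Finset.sum_sub_distrib, sum_choiceFlow, sum_choiceFlow, signedSum_one_one]
    omega

end Completeness

theorem orientable_reductionEdges {k n : ℕ} {p : ℕ → ℕ} {a : ℕ → ℕ → ℕ} (hk : 0 < k)
    (hn : 0 < n) : Orientable (reductionEdges k n p a) 0 ↔
      ∃ x : ℕ → ℕ, (∀ c < k, x c < n ∧ p (x c) = c) ∧
        ∀ c < k, ∀ c' < k, c ≠ c' → a (x c) (x c') ≠ 0 := by
  rw [reductionEdges, orientable_gridEdges (by simp [rowCaps]) (by simp [columnCaps])]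
  constructor
  · rintro ⟨H, V, hH, hV, -, zV, hb⟩
    have h0 := hH 0 (by omega) 0 (by omega)
    rw [rowCaps, if_neg (by omega), if_pos rfl, signedSum_returnCaps] at h0
    obtain ⟨e, s, he, hs, h0 | h0⟩ := h0
    -- The returning row flows to the right here; reversing every edge reduces this to the other
    -- case.
    · refine exists_choice_of_flow hk hn (H := fun t r => -H t r) (V := fun t r => -V t r)
        (fun t ht r hr => (hH t ht r hr).neg) (fun t ht r hr => (hV t ht r hr).neg)
        (fun t => by simp [zV]) (fun t ht r hr => ?_) ⟨k * n - e, -s, by omega, by omega, ?_⟩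
      · have := hb t ht r hr
        simp only [gridExcess] at this ⊢
        split_ifs at this ⊢ <;> omega
      · rw [h0]
        push_cast [he]
        ring
    · exact exists_choice_of_flow hk hn hH hV zV hb ⟨e, s, he, hs, h0⟩
  · rintro ⟨x, hpx, hadj⟩
    exact ⟨rowFlow k n a x, columnFlow k n a x,
      fun t _ r hr => signedSum_rowFlow hpx hadj hr,
      fun t ht r hr => signedSum_columnFlow hpx hadj ht hr,
      fun r => by simp [rowFlow], columnFlow_last, fun t _ r _ => gridExcess_flow t r⟩

/-! ### Rules for random access machines

An environment is a list of values of the registers `0, 1, …`; the registers beyond are free. -/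

def RAMExpr.Below (d : ℕ) : RAMExpr → Prop
  | const _ => True
  | reg x => x < d
  | mem e => e.Below d
  | add e f => e.Below d ∧ f.Below d
  | sub e f => e.Below d ∧ f.Below d

/-- The registers beyond the environment and the output tape are left unconstrained. -/
def RAMState.Agrees (ρ : List ℕ) (μ : ℕ → ℕ) (s : RAMState) : Prop :=
  (∀ i < ρ.length, s.reg i = ρ.getD i 0) ∧ s.mem = μ

/-- The value of an expression in an environment. -/
def RAMExpr.value (ρ : List ℕ) (μ : ℕ → ℕ) (e : RAMExpr) : ℕ :=
  e.eval ⟨fun i => ρ.getD i 0, μ, []⟩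

lemma RAMExpr.eval_eq_value {ρ : List ℕ} {μ : ℕ → ℕ} {s : RAMState} (hs : s.Agrees ρ μ)
    {e : RAMExpr} (he : e.Below ρ.length) : e.eval s = e.value ρ μ := by
  unfold RAMExpr.value
  induction e with
  | const a => rfl
  | reg x => exact hs.1 x he
  | mem e ih => simp only [eval, ih he, hs.2]
  | add e f ihe ihf => simp only [eval, ihe he.1, ihf he.2]
  | sub e f ihe ihf => simp only [eval, ihe he.1, ihf he.2]

lemma RAMState.Agrees.of_append {ρ : List ℕ} {v : ℕ} {μ : ℕ → ℕ} {s : RAMState}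
    (h : s.Agrees (ρ ++ [v]) μ) : s.Agrees ρ μ ∧ s.reg ρ.length = v := by
  refine ⟨⟨fun i hi => ?_, h.2⟩, ?_⟩
  · rw [h.1 i (by simp; omega), List.getD_append _ _ _ _ hi]
  · rw [h.1 _ (by simp), List.getD_append_right _ _ _ _ le_rfl]
    simp

lemma RAMState.Agrees.append {ρ : List ℕ} {v : ℕ} {μ : ℕ → ℕ} {s : RAMState}
    (h : s.Agrees ρ μ) (hv : s.reg ρ.length = v) : s.Agrees (ρ ++ [v]) μ := by
  refine ⟨fun i hi => ?_, h.2⟩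
  rcases Nat.lt_or_ge i ρ.length with h' | h'
  · rw [h.1 i h', List.getD_append _ _ _ _ h']
  · obtain rfl : i = ρ.length := by simp at hi; omega
    rw [hv, List.getD_append_right _ _ _ _ le_rfl]
    simp

def RAMState.set (s : RAMState) (x v : ℕ) : RAMState :=
  { s with reg := Function.update s.reg x v }

lemma RAMState.Agrees.set {ρ : List ℕ} {μ : ℕ → ℕ} {s : RAMState}
    (h : s.Agrees ρ μ) (x : ℕ) (hx : ρ.length ≤ x) (v : ℕ) :
    (s.set x v).Agrees ρ μ := by
  refine ⟨fun i hi => ?_, h.2⟩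
  change Function.update s.reg x v i = _
  rw [Function.update_of_ne (by omega)]
  exact h.1 i hi

/-- In the environment `ρ`, the program writes the list `L` in at most `T` steps and restores the
environment. -/
def Emits (μ : ℕ → ℕ) (P : RAMProgram) (ρ L : List ℕ) (T : ℕ) : Prop :=
  ∀ s : RAMState, s.Agrees ρ μ → ∃ t s', RAMExec P s t s' ∧ t ≤ T ∧ s'.Agrees ρ μ ∧
    s'.out = s.out ++ L

/-- In the environment `ρ`, the program puts the number `v` into the first free register, in at most
`T` steps. -/
def Computes (μ : ℕ → ℕ) (P : RAMProgram) (ρ : List ℕ) (v T : ℕ) : Prop :=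
  ∀ s : RAMState, s.Agrees ρ μ → ∃ t s', RAMExec P s t s' ∧ t ≤ T ∧ s'.Agrees (ρ ++ [v]) μ ∧
    s'.out = s.out

namespace RAMProgram

def forLoop (d : ℕ) (e : RAMExpr) (P : RAMProgram) : RAMProgram :=
  .seq (.assign d (.const 0)) (.loop (.reg d) e (.seq P (.assign d (.add (.reg d) (.const 1)))))

/-- Register `d` becomes the sum of what `P` puts into register `d + 2`, while register `d + 1` runs
through the numbers below `e`. -/
def sumLoop (d : ℕ) (e : RAMExpr) (P : RAMProgram) : RAMProgram :=
  .seq (.assign d (.const 0)) (.seq (.assign (d + 1) (.const 0)) (.loop (.reg (d + 1)) e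
    (.seq P (.seq (.assign d (.add (.reg d) (.reg (d + 2))))
      (.assign (d + 1) (.add (.reg (d + 1)) (.const 1)))))))

def mul (d : ℕ) (e f : RAMExpr) : RAMProgram := sumLoop d e (.assign (d + 2) f)

/-- Equality is the failure of both strict comparisons, hence two copies of `Q`. -/
def ifEq (a b : RAMExpr) (P Q : RAMProgram) : RAMProgram := .branch a b Q (.branch b a Q P)

def writeEdge (x y c : RAMExpr) : RAMProgram := .seq (.write x) (.seq (.write y) (.write c))

end RAMProgram

/-! ### Correctness and running time of program fragments -/

section Rules

variable {μ : ℕ → ℕ} {ρ L L' : List ℕ} {P Q : RAMProgram} {v w T T' : ℕ}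

lemma Emits.of_eq (h : Emits μ P ρ L T) (hL : L = L') : Emits μ P ρ L' T := hL ▸ h

lemma Emits.mono (h : Emits μ P ρ L T) (hT : T ≤ T') : Emits μ P ρ L T' := by
  intro s hs
  obtain ⟨t, s', h1, h2, h3⟩ := h s hs
  exact ⟨t, s', h1, h2.trans hT, h3⟩

lemma Computes.of_eq (h : Computes μ P ρ v T) (hv : v = w) : Computes μ P ρ w T := hv ▸ h

lemma Computes.mono (h : Computes μ P ρ v T) (hT : T ≤ T') : Computes μ P ρ v T' := by
  intro s hs
  obtain ⟨t, s', h1, h2, h3⟩ := h s hs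
  exact ⟨t, s', h1, h2.trans hT, h3⟩

lemma Emits.nop : Emits μ .nop ρ [] 1 := fun s hs => ⟨1, s, .nop s, le_rfl, hs, by simp⟩

lemma Emits.write {e : RAMExpr} (he : e.Below ρ.length) :
    Emits μ (.write e) ρ [e.value ρ μ] (e.cost + 1) := fun s hs =>
  ⟨_, _, .write e s, le_rfl, hs, by rw [RAMExpr.eval_eq_value hs he]⟩

lemma Emits.seq (h : Emits μ P ρ L T) (h' : Emits μ Q ρ L' T') :
    Emits μ (.seq P Q) ρ (L ++ L') (T + T') := by
  intro s hs
  obtain ⟨t, s', h1, h2, h3, h4⟩ := h s hs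
  obtain ⟨t', s'', h1', h2', h3', h4'⟩ := h' s' h3
  exact ⟨_, s'', .seq h1 h1', by omega, h3', by rw [h4', h4, List.append_assoc]⟩

/-- The computed value is a local variable of `Q`: its register counts as free again afterwards. -/
lemma Emits.bind (h : Computes μ P ρ v T) (h' : Emits μ Q (ρ ++ [v]) L T') :
    Emits μ (.seq P Q) ρ L (T + T') := by
  intro s hs
  obtain ⟨t, s', h1, h2, h3, h4⟩ := h s hs
  obtain ⟨t', s'', h1', h2', h3', h4'⟩ := h' s' h3
  exact ⟨_, s'', .seq h1 h1', by omega, h3'.of_append.1, by rw [h4', h4]⟩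

lemma Emits.branch {a b : RAMExpr} (ha : a.Below ρ.length) (hb : b.Below ρ.length)
    (h : a.value ρ μ < b.value ρ μ → Emits μ P ρ L T)
    (h' : ¬ a.value ρ μ < b.value ρ μ → Emits μ Q ρ L T') :
    Emits μ (.branch a b P Q) ρ L (a.cost + b.cost + 1 + (T + T')) := by
  intro s hs
  by_cases hab : a.value ρ μ < b.value ρ μ
  · obtain ⟨t, s', h1, h2, h3⟩ := h hab s hs
    refine ⟨_, s', .branch_true ?_ h1, by omega, h3⟩
    rwa [RAMExpr.eval_eq_value hs ha, RAMExpr.eval_eq_value hs hb]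
  · obtain ⟨t, s', h1, h2, h3⟩ := h' hab s hs
    refine ⟨_, s', .branch_false ?_ h1, by omega, h3⟩
    rwa [RAMExpr.eval_eq_value hs ha, RAMExpr.eval_eq_value hs hb]

lemma Computes.branch {a b : RAMExpr} (ha : a.Below ρ.length) (hb : b.Below ρ.length)
    (h : a.value ρ μ < b.value ρ μ → Computes μ P ρ v T)
    (h' : ¬ a.value ρ μ < b.value ρ μ → Computes μ Q ρ v T') :
    Computes μ (.branch a b P Q) ρ v (a.cost + b.cost + 1 + (T + T')) := by
  intro s hs
  by_cases hab : a.value ρ μ < b.value ρ μ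
  · obtain ⟨t, s', h1, h2, h3⟩ := h hab s hs
    refine ⟨_, s', .branch_true ?_ h1, by omega, h3⟩
    rwa [RAMExpr.eval_eq_value hs ha, RAMExpr.eval_eq_value hs hb]
  · obtain ⟨t, s', h1, h2, h3⟩ := h' hab s hs
    refine ⟨_, s', .branch_false ?_ h1, by omega, h3⟩
    rwa [RAMExpr.eval_eq_value hs ha, RAMExpr.eval_eq_value hs hb]

lemma Computes.ifEq {a b : RAMExpr} (ha : a.Below ρ.length) (hb : b.Below ρ.length)
    (h : a.value ρ μ = b.value ρ μ → Computes μ P ρ v T)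
    (h' : a.value ρ μ ≠ b.value ρ μ → Computes μ Q ρ v T') :
    Computes μ (RAMProgram.ifEq a b P Q) ρ v (2 * (a.cost + b.cost + 1 + T') + T) :=
  (Computes.branch ha hb (fun hab => h' hab.ne) fun hab =>
    Computes.branch hb ha (fun hab' => h' hab'.ne') fun hab' => h (by omega)).mono (by omega)

lemma Computes.assign {d : ℕ} (hd : ρ.length = d) {e : RAMExpr} (he : e.Below ρ.length) :
    Computes μ (.assign d e) ρ (e.value ρ μ) (e.cost + 1) := by
  subst hd
  intro s hs
  refine ⟨_, _, .assign _ e s, le_rfl, (hs.set _ le_rfl _).append ?_, rfl⟩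
  change Function.update s.reg _ _ _ = _
  rw [Function.update_self, RAMExpr.eval_eq_value hs he]

lemma Emits.forLoop {d : ℕ} (hd : ρ.length = d) {e : RAMExpr} (he : e.Below ρ.length) {m : ℕ}
    (hm : e.value ρ μ = m) {L : ℕ → List ℕ} (h : ∀ i < m, Emits μ P (ρ ++ [i]) (L i) T) :
    Emits μ (RAMProgram.forLoop d e P) ρ ((List.range m).flatMap L)
      (m * (T + e.cost + 6) + e.cost + 4) := by
  subst hd
  -- Induction on the number `j` of remaining rounds, with the counter `i` arbitrary.
  have key : ∀ j i, i + j = m → ∀ s : RAMState, s.Agrees (ρ ++ [i]) μ → ∃ t s', RAMExec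
      (.loop (.reg ρ.length) e (.seq P (.assign ρ.length (.add (.reg ρ.length) (.const 1)))))
      s t s' ∧ t ≤ j * (T + e.cost + 6) + e.cost + 2 ∧ s'.Agrees ρ μ ∧
      s'.out = s.out ++ (List.range' i j).flatMap L := by
    intro j
    induction j with
    | zero =>
      intro i hi s hs
      obtain ⟨hs1, hs2⟩ := hs.of_append
      refine ⟨_, s, .loop_false ?_, ?_, hs1, by simp⟩
      · rw [RAMExpr.eval_eq_value hs1 he, hm]
        simp only [RAMExpr.eval, hs2]
        omega
      · simp only [RAMExpr.cost]
        omega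
    | succ j ih =>
      intro i hi s hs
      obtain ⟨hs1, hs2⟩ := hs.of_append
      obtain ⟨t, s', h1, h2, h3, h4⟩ := h i (by omega) s hs
      obtain ⟨hs1', hs2'⟩ := h3.of_append
      obtain ⟨t', s'', h1', h2', h3', h4'⟩ := ih (i + 1) (by omega)
        (s'.set ρ.length ((RAMExpr.add (.reg ρ.length) (.const 1)).eval s'))
        ((hs1'.set _ le_rfl _).append (by simp [RAMState.set, RAMExpr.eval, hs2']))
      refine ⟨_, s'', .loop_true ?_ (.seq h1 (.assign _ _ _)) h1', ?_, h3', ?_⟩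
      · rw [RAMExpr.eval_eq_value hs1 he, hm]
        simp only [RAMExpr.eval, hs2]
        omega
      · simp only [RAMExpr.cost]
        rw [Nat.succ_mul]
        omega
      · rw [h4', RAMState.set, h4, List.range'_succ, List.flatMap_cons, List.append_assoc]
  intro s hs
  obtain ⟨t, s', h1, h2, h3, h4⟩ := key m 0 (by omega)
    (s.set ρ.length ((RAMExpr.const 0).eval s))
    ((hs.set _ le_rfl _).append (by simp [RAMState.set, RAMExpr.eval]))
  refine ⟨_, s', .seq (.assign _ _ _) h1, ?_, h3, ?_⟩
  · simp only [RAMExpr.cost]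
    omega
  · rw [h4, RAMState.set, List.range_eq_range']

/-- The body has to work for every partial sum `x`, since that value occupies the register below the
counter. -/
lemma Computes.sumLoop {d : ℕ} (hd : ρ.length = d) {e : RAMExpr} (he : e.Below ρ.length) {m : ℕ}
    (hm : e.value ρ μ = m) {f : ℕ → ℕ} (h : ∀ x, ∀ i < m, Computes μ P (ρ ++ [x] ++ [i]) (f i) T) :
    Computes μ (RAMProgram.sumLoop d e P) ρ (∑ i ∈ Finset.range m, f i)
      (m * (T + e.cost + 10) + e.cost + 6) := by
  subst hd
  have key : ∀ j i x, i + j = m → ∀ s : RAMState, s.Agrees (ρ ++ [x] ++ [i]) μ → ∃ t s', RAMExec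
      (.loop (.reg (ρ.length + 1)) e
        (.seq P (.seq (.assign ρ.length (.add (.reg ρ.length) (.reg (ρ.length + 2))))
          (.assign (ρ.length + 1) (.add (.reg (ρ.length + 1)) (.const 1))))))
      s t s' ∧ t ≤ j * (T + e.cost + 10) + e.cost + 2 ∧
      s'.Agrees (ρ ++ [x + ∑ l ∈ Finset.range j, f (i + l)]) μ ∧ s'.out = s.out := by
    intro j
    induction j with
    | zero =>
      intro i x hi s hs
      obtain ⟨hs1, hs2⟩ := hs.of_append
      obtain ⟨hs3, -⟩ := hs1.of_append
      refine ⟨_, s, .loop_false ?_, ?_, by simpa using hs1, rfl⟩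
      · rw [RAMExpr.eval_eq_value hs3 he, hm]
        simp only [List.length_append, List.length_singleton] at hs2
        simp only [RAMExpr.eval, hs2]
        omega
      · simp only [RAMExpr.cost]
        omega
    | succ j ih =>
      intro i x hi s hs
      obtain ⟨hs1, hs2⟩ := hs.of_append
      obtain ⟨hs3, -⟩ := hs1.of_append
      obtain ⟨t, s', h1, h2, h3, h4⟩ := h x i (by omega) s hs
      obtain ⟨hs1', hs2'⟩ := h3.of_append
      obtain ⟨hs3', hs4'⟩ := hs1'.of_append
      obtain ⟨hs5', hs6'⟩ := hs3'.of_append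
      simp only [List.length_append, List.length_singleton] at hs2 hs2' hs4'
      let s1 : RAMState := s'.set ρ.length
        ((RAMExpr.add (.reg ρ.length) (.reg (ρ.length + 2))).eval s')
      have hs1A : s1.Agrees (ρ ++ [x + f i]) μ :=
        (hs5'.set _ le_rfl _).append (by simp [RAMState.set, RAMExpr.eval, hs6', hs2'])
      have hs1R : s1.reg (ρ.length + 1) = i := by
        change Function.update s'.reg _ _ _ = _
        rw [Function.update_of_ne (by omega)]
        exact hs4'
      obtain ⟨t', s'', h1', h2', h3', h4'⟩ := ih (i + 1) (x + f i) (by omega)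
        (s1.set (ρ.length + 1) ((RAMExpr.add (.reg (ρ.length + 1)) (.const 1)).eval s1))
        ((hs1A.set _ (by simp) _).append (by simp [RAMState.set, RAMExpr.eval, hs1R]))
      refine ⟨_, s'', .loop_true ?_ (.seq h1 (.seq (.assign _ _ _) (.assign _ _ _))) h1', ?_, ?_, ?_⟩
      · rw [RAMExpr.eval_eq_value hs3 he, hm]
        simp only [RAMExpr.eval, hs2]
        omega
      · simp only [RAMExpr.cost]
        rw [Nat.succ_mul]
        omega
      · rw [Finset.sum_range_succ']
        simp only [add_zero]
        convert h3' using 3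
        rw [add_comm (∑ l ∈ _, _), ← add_assoc]
        simp only [add_assoc, add_comm 1]
      · exact h4'.trans h4
  intro s hs
  let s1 : RAMState := s.set ρ.length ((RAMExpr.const 0).eval s)
  have hs1A : s1.Agrees (ρ ++ [0]) μ :=
    (hs.set _ le_rfl _).append (by simp [RAMState.set, RAMExpr.eval])
  obtain ⟨t, s', h1, h2, h3, h4⟩ := key m 0 0 (by omega)
    (s1.set (ρ.length + 1) ((RAMExpr.const 0).eval s1))
    ((hs1A.set _ (by simp) _).append (by simp [RAMState.set, RAMExpr.eval]))
  refine ⟨_, s', .seq (.assign _ _ _) (.seq (.assign _ _ _) h1), ?_, by simpa using h3, h4⟩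
  simp only [RAMExpr.cost]
  omega

/-- The time is proportional to the first factor only, so products are arranged with the small
factor first. -/
lemma Computes.mul {d : ℕ} (hd : ρ.length = d) {e f : RAMExpr} (he : e.Below ρ.length)
    (hf : f.Below ρ.length) : Computes μ (RAMProgram.mul d e f) ρ (e.value ρ μ * f.value ρ μ)
      (e.value ρ μ * (f.cost + e.cost + 11) + e.cost + 6) := by
  subst hd
  refine ((Computes.sumLoop (f := fun _ => f.value ρ μ) (T := f.cost + 1) rfl he rfl ?_).mono
    (by rw [show f.cost + 1 + e.cost + 10 = f.cost + e.cost + 11 by omega])).of_eq (by simp)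
  intro x i _ s hs
  obtain ⟨hs1, -⟩ := hs.of_append
  obtain ⟨hs2, -⟩ := hs1.of_append
  refine ⟨_, _, .assign _ f s, le_rfl, (hs.set _ (by simp) _).append ?_, rfl⟩
  simp [RAMState.set, RAMExpr.eval_eq_value hs2 hf]

lemma Computes.mul_of_eq {d : ℕ} (hd : ρ.length = d) {e f : RAMExpr} (he : e.Below ρ.length)
    (hf : f.Below ρ.length) {x y : ℕ} (hx : e.value ρ μ = x) (hy : f.value ρ μ = y)
    (hv : x * y = v) (hT : x * (f.cost + e.cost + 11) + e.cost + 6 ≤ T) :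
    Computes μ (RAMProgram.mul d e f) ρ v T := by
  subst hx hy hv
  exact (Computes.mul hd he hf).mono hT

lemma Emits.writeEdge {x y c : RAMExpr} (hx : x.Below ρ.length) (hy : y.Below ρ.length)
    (hc : c.Below ρ.length) : Emits μ (RAMProgram.writeEdge x y c) ρ
      [x.value ρ μ, y.value ρ μ, c.value ρ μ] (x.cost + y.cost + c.cost + 3) :=
  ((Emits.write hx).seq ((Emits.write hy).seq (Emits.write hc))).mono (by omega)

end Rules

/-! ### The program -/

/-- The numbers by which a list of edges is written down. -/
def flat (L : List (ℕ × ℕ × ℕ)) : List ℕ := L.flatMap fun e => [e.1, e.2.1, e.2.2]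

lemma flat_append (L L' : List (ℕ × ℕ × ℕ)) : flat (L ++ L') = flat L ++ flat L' :=
  List.flatMap_append

lemma flat_flatMap {α : Type*} (l : List α) (L : α → List (ℕ × ℕ × ℕ)) :
    flat (l.flatMap L) = l.flatMap fun i => flat (L i) :=
  List.flatMap_assoc

lemma flat_bundle_map_range (x y m : ℕ) (f : ℕ → ℕ) :
    flat (bundle x y ((List.range m).map f)) =
      (List.range m).flatMap fun i => flat [(x, y, f i)] := by
  simp [flat, bundle, List.flatMap_map]

lemma flat_bundle_replicate (x y m c : ℕ) :
    flat (bundle x y (List.replicate m c)) =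
      (List.range m).flatMap fun _ => flat [(x, y, c)] := by
  rw [← flat_bundle_map_range, List.map_const', List.length_range]

lemma bundle_append (x y : ℕ) (l l' : List ℕ) :
    bundle x y (l ++ l') = bundle x y l ++ bundle x y l' :=
  List.map_append

namespace RAMProgram

open RAMExpr

def rowEdge (c : RAMExpr) : RAMProgram :=
  writeEdge (add (reg 11) (reg 12)) (add (add (reg 11) (reg 12)) (add (reg 1) (const 1))) c

def columnEdge (c : RAMExpr) : RAMProgram :=
  writeEdge (add (reg 11) (reg 12)) (add (add (reg 11) (reg 12)) (const 1)) c

def returnRow : RAMProgram :=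
  .seq (rowEdge (reg 4)) (.seq (forLoop 13 (reg 2) (rowEdge (const 64)))
    (.seq (rowEdge (const 1)) (rowEdge (const 1))))

def startRow : RAMProgram :=
  .seq (rowEdge (reg 3)) (forLoop 13 (reg 0) (rowEdge (const 64)))

def double (e : RAMExpr) : RAMExpr := add e e

def times64 (e : RAMExpr) : RAMExpr := double (double (double (double (double (double e)))))

def choiceExpr (w : RAMExpr) : RAMExpr := times64 (add (add (reg 2) (const 1)) w)

/-- Puts the capacity of the choice `w` into register `d`. -/
def choice (d : ℕ) (w : RAMExpr) : RAMProgram :=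
  ifEq (add (mem (add (const 3) w)) (const 1)) (reg 12)
    (.branch (const 0) (mem (add (add (const 3) (reg 0)) (add (reg 9) (reg 10))))
      (.assign d (choiceExpr w))
      (ifEq w (reg 8) (.assign d (sub (choiceExpr w) (const 1)))
        (ifEq w (reg 10) (.assign d (sub (choiceExpr w) (const 1))) (.assign d (choiceExpr w)))))
    (.assign d (const 0))

def testRow : RAMProgram :=
  .seq (forLoop 13 (reg 0) (.seq (choice 14 (reg 13)) (rowEdge (reg 14))))
    (.seq (sumLoop 13 (reg 0) (choice 15 (reg 14))) (rowEdge (reg 13)))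

def innerColumn : RAMProgram :=
  .branch (reg 12) (reg 1) (.seq (columnEdge (const 1)) (columnEdge (const 1))) .nop

def boundaryColumn : RAMProgram :=
  .branch (reg 12) (reg 1) (.seq (columnEdge (const 1)) (.seq (columnEdge (const 1))
    (forLoop 13 (reg 5) (columnEdge (const 64))))) .nop

/-- The edges that start in a column; `P` writes those of the returning row, and `Q` those of the
other rows, that lead to the next column. -/
def wholeColumn (P Q C : RAMProgram) : RAMProgram :=
  forLoop 12 (add (reg 1) (const 1)) (.seq (.branch (const 0) (reg 12) Q P) C)

def withRegisters (Q : RAMProgram) : RAMProgram :=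
  .seq (.assign 8 (const 0)) (.seq (.assign 9 (const 0)) (.seq (.assign 10 (const 0)) Q))

def firstColumn : RAMProgram :=
  withRegisters (.seq (.assign 11 (const 0)) (wholeColumn returnRow startRow boundaryColumn))

def middleColumns : RAMProgram :=
  forLoop 8 (reg 0) (.seq (mul 9 (reg 0) (reg 8)) (forLoop 10 (reg 0)
    (.seq (mul 11 (add (reg 1) (const 1)) (add (add (reg 9) (reg 10)) (const 1)))
      (wholeColumn returnRow testRow innerColumn))))

def lastColumn : RAMProgram :=
  withRegisters (.seq (mul 11 (add (reg 1) (const 1)) (add (reg 6) (const 1)))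
    (wholeColumn .nop .nop boundaryColumn))

def mainPart : RAMProgram :=
  .seq (mul 2 (reg 1) (reg 0)) <|
  .seq (.assign 3 (times64 (add (double (add (reg 2) (const 1))) (reg 0)))) <|
  .seq (mul 4 (reg 1) (reg 3)) <|
  .seq (mul 5 (reg 1) (double (add (add (reg 2) (const 1)) (reg 0)))) <|
  .seq (mul 6 (reg 0) (reg 0)) <|
  .seq (mul 7 (add (reg 1) (const 1)) (add (reg 6) (const 2))) <|
  .seq (.write (reg 7)) <| .seq firstColumn <| .seq middleColumns lastColumn

def degeneratePart : RAMProgram :=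
  .branch (const 0) (reg 1)
    (.seq (.write (const 2)) (writeEdge (const 0) (const 1) (const 1))) (.write (const 0))

def reduction : RAMProgram :=
  .seq (.assign 0 (mem (const 2))) (.seq (.assign 1 (mem (const 0)))
    (.branch (const 0) (reg 0) mainPart degeneratePart))

end RAMProgram

/-- The position in the list is the register number, so this fixes the meaning of registers `0` to
`7` in the programs above. -/
def globalEnv (n k : ℕ) : List ℕ :=
  [n, k, k * n, 64 * (2 * offset k n + n), k * (64 * (2 * offset k n + n)),
    2 * (k * (offset k n + n)), n * n, (n * n + 2) * (k + 1)]

/-- Registers `9` and `11` cache products, so that addresses and vertex numbers need only additions.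
-/
def columnEnv (n k u v t : ℕ) : List ℕ := globalEnv n k ++ [u, u * n, v, t * (k + 1)]

def rowEnv (n k u v t r : ℕ) (σ : List ℕ) : List ℕ := columnEnv n k u v t ++ r :: σ

section Program

open RAMExpr RAMProgram

variable {μ : ℕ → ℕ} {n k u v t r : ℕ} {σ : List ℕ}

lemma below_const {a d : ℕ} : (const a).Below d := trivial

lemma length_rowEnv : (rowEnv n k u v t r σ).length = 13 + σ.length := by
  simp [rowEnv, columnEnv, globalEnv]
  omega

lemma emits_rowEdge {c : RAMExpr} {x : ℕ} (hc : c.Below (13 + σ.length))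
    (hx : c.value (rowEnv n k u v t r σ) μ = x) :
    Emits μ (rowEdge c) (rowEnv n k u v t r σ)
      (flat [(t * (k + 1) + r, (t + 1) * (k + 1) + r, x)]) (c.cost + 13) := by
  refine ((Emits.writeEdge ?_ ?_ ?_).mono ?_).of_eq ?_
  · simp [Below, length_rowEnv]; omega
  · simp [Below, length_rowEnv]; omega
  · rwa [length_rowEnv]
  · simp [cost]; omega
  · have h1 : (add (add (reg 11) (reg 12)) (add (reg 1) (const 1))).value
        (rowEnv n k u v t r σ) μ = t * (k + 1) + r + (k + 1) := rfl
    have h2 : (add (reg 11) (reg 12)).value (rowEnv n k u v t r σ) μ = t * (k + 1) + r := rfl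
    rw [h1, h2, hx]
    simp [flat]
    ring

lemma emits_columnEdge {c : RAMExpr} {x : ℕ} (hc : c.Below (13 + σ.length))
    (hx : c.value (rowEnv n k u v t r σ) μ = x) :
    Emits μ (columnEdge c) (rowEnv n k u v t r σ)
      (flat [(t * (k + 1) + r, t * (k + 1) + r + 1, x)]) (c.cost + 11) := by
  refine ((Emits.writeEdge ?_ ?_ ?_).mono ?_).of_eq ?_
  · simp [Below, length_rowEnv]; omega
  · simp [Below, length_rowEnv]; omega
  · rwa [length_rowEnv]
  · simp [cost]; omega
  · have h1 : (add (add (reg 11) (reg 12)) (const 1)).value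
        (rowEnv n k u v t r σ) μ = t * (k + 1) + r + 1 := rfl
    have h2 : (add (reg 11) (reg 12)).value (rowEnv n k u v t r σ) μ = t * (k + 1) + r := rfl
    rw [h1, h2, hx]
    simp [flat]

lemma emits_returnRow : Emits μ returnRow (rowEnv n k u v t r [])
    (flat (bundle (t * (k + 1) + r) ((t + 1) * (k + 1) + r) (returnCaps k n)))
    (k * n * 21 + 47) := by
  refine (((emits_rowEdge (by simp [Below]) rfl).seq ((Emits.forLoop rfl
    (by simp [Below, length_rowEnv]) rfl
    fun i _ => emits_rowEdge (σ := [i]) below_const rfl).seq ((emits_rowEdge below_const rfl).seq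
    (emits_rowEdge below_const rfl)))).mono ?_).of_eq ?_
  · have h : (reg 2).value (rowEnv n k u v t r []) μ = k * n := rfl
    rw [h]
    simp [cost]
    omega
  · have h : (reg 2).value (rowEnv n k u v t r []) μ = k * n := rfl
    have h4 : (reg 4).value (rowEnv n k u v t r []) μ = k * (64 * (2 * offset k n + n)) := rfl
    have h1 : (const 1).value (rowEnv n k u v t r []) μ = 1 := rfl
    have h64 : ∀ i, (const 64).value (rowEnv n k u v t r [i]) μ = 64 := fun _ => rfl
    rw [returnCaps, bundle_append, bundle_append, flat_append, flat_append, flat_bundle_replicate,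
      h, h4, h1]
    simp only [h64]
    simp [flat, bundle]
    ring

lemma emits_startRow : Emits μ startRow (rowEnv n k u v t r [])
    (flat (bundle (t * (k + 1) + r) ((t + 1) * (k + 1) + r) (startCaps k n))) (n * 21 + 19) := by
  refine (((emits_rowEdge (by simp [Below]) rfl).seq (Emits.forLoop rfl
    (by simp [Below, length_rowEnv]) (show _ = n from rfl)
    fun i _ => emits_rowEdge (σ := [i]) below_const rfl)).mono ?_).of_eq ?_
  · simp [cost]
    omega
  · have h3 : (reg 3).value (rowEnv n k u v t r []) μ = 64 * (2 * offset k n + n) := rfl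
    have h64 : ∀ i, (const 64).value (rowEnv n k u v t r [i]) μ = 64 := fun _ => rfl
    rw [startCaps, bundle_append, flat_append, flat_bundle_replicate, h3]
    simp only [h64]
    rfl

lemma value_choiceExpr {x w : ℕ} (hw : (reg x).value (rowEnv n k u v t r σ) μ = w) :
    (choiceExpr (reg x)).value (rowEnv n k u v t r σ) μ = 64 * (offset k n + w) := by
  have h : (add (add (reg 2) (const 1)) (reg x)).value (rowEnv n k u v t r σ) μ =
      offset k n + (reg x).value (rowEnv n k u v t r σ) μ := rfl
  have hd : ∀ e : RAMExpr, (double e).value (rowEnv n k u v t r σ) μ =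
    e.value (rowEnv n k u v t r σ) μ + e.value (rowEnv n k u v t r σ) μ := fun _ => rfl
  rw [choiceExpr, times64, hd, hd, hd, hd, hd, hd, h, hw]
  ring

lemma below_choiceExpr {x d : ℕ} (hx : x < d) (hd : 13 ≤ d) : (choiceExpr (reg x)).Below d := by
  simp [choiceExpr, times64, double, Below]
  omega

/-- Register `12` holds the row, one more than the class, which is why the program compares it with
the class of `w` plus one. The expression for a choice costs 383 steps, because each of the six
doublings evaluates its argument twice; the remaining bounds are generous. -/
lemma computes_choice {x d w : ℕ} (hd : (rowEnv n k u v t (r + 1) σ).length = d) (hx : x < d)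
    (hw : (reg x).value (rowEnv n k u v t (r + 1) σ) μ = w) :
    Computes μ (choice d (reg x)) (rowEnv n k u v t (r + 1) σ)
      (choiceCap k n (fun w => μ (3 + w)) (fun u v => μ (3 + n + (u * n + v))) u v r w) 4000 := by
  have hd13 : 13 ≤ d := by
    rw [← hd, length_rowEnv]
    omega
  have hb := below_choiceExpr hx hd13
  have hv := value_choiceExpr hw
  have hp : (add (mem (add (const 3) (reg x))) (const 1)).value (rowEnv n k u v t (r + 1) σ) μ =
      μ (3 + w) + 1 := by
    rw [← hw]
    rfl
  have ha : (mem (add (add (const 3) (reg 0)) (add (reg 9) (reg 10)))).value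
      (rowEnv n k u v t (r + 1) σ) μ = μ (3 + n + (u * n + v)) := rfl
  have h12 : (reg 12).value (rowEnv n k u v t (r + 1) σ) μ = r + 1 := rfl
  have h8 : (reg 8).value (rowEnv n k u v t (r + 1) σ) μ = u := rfl
  have h10 : (reg 10).value (rowEnv n k u v t (r + 1) σ) μ = v := rfl
  have h0 : (const 0).value (rowEnv n k u v t (r + 1) σ) μ = 0 := rfl
  have hs : (sub (choiceExpr (reg x)) (const 1)).value (rowEnv n k u v t (r + 1) σ) μ =
      64 * (offset k n + w) - 1 := by
    rw [← hv]
    rfl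
  have hB : (sub (choiceExpr (reg x)) (const 1)).Below (rowEnv n k u v t (r + 1) σ).length := by
    rw [hd]
    exact ⟨hb, trivial⟩
  have hB' : (choiceExpr (reg x)).Below (rowEnv n k u v t (r + 1) σ).length := by rwa [hd]
  refine (Computes.ifEq (T := 3500) (T' := 2) ?_ ?_ ?_ ?_).mono ?_
  · simpa [Below, hd] using hx
  · simp [Below, hd]; omega
  · rw [hp, h12]
    intro hpw
    have hpw' : μ (3 + w) = r := by omega
    refine (Computes.branch (T := 400) (T' := 3000) below_const ?_ ?_ ?_).mono ?_
    · simp [Below, hd]; omega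
    · rw [ha, h0]
      intro h
      refine ((Computes.assign hd hB').mono ?_).of_eq ?_
      · simp [choiceExpr, times64, double, cost]
      · rw [hv]
        simp [choiceCap, hpw', hit, h.ne']
    · rw [ha, h0]
      intro h
      have h' : μ (3 + n + (u * n + v)) = 0 := by omega
      refine (Computes.ifEq (T := 400) (T' := 1200) ?_ ?_ ?_ ?_).mono ?_
      · simpa [Below, hd] using hx
      · simp [Below, hd]; omega
      · rw [hw, h8]
        intro hwu
        refine ((Computes.assign hd hB).mono ?_).of_eq ?_
        · simp [choiceExpr, times64, double, cost]
        · rw [hs]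
          rw [choiceCap, if_pos hpw', hit, if_pos ⟨h', .inl hwu⟩]
      · rw [hw, h8]
        intro hwu
        refine (Computes.ifEq (T := 400) (T' := 390) ?_ ?_ ?_ ?_).mono ?_
        · simpa [Below, hd] using hx
        · simp [Below, hd]; omega
        · rw [hw, h10]
          intro hwv
          refine ((Computes.assign hd hB).mono ?_).of_eq ?_
          · simp [choiceExpr, times64, double, cost]
          · rw [hs]
            rw [choiceCap, if_pos hpw', hit, if_pos ⟨h', .inr hwv⟩]
        · rw [hw, h10]
          intro hwv
          refine ((Computes.assign hd hB').mono ?_).of_eq ?_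
          · simp [choiceExpr, times64, double, cost]
          · rw [hv]
            simp [choiceCap, hpw', hit, hwu, hwv]
        · simp [cost]
      · simp [cost]
    · simp [cost]
  · rw [hp, h12]
    intro hpw
    refine ((Computes.assign hd below_const).mono ?_).of_eq ?_
    · simp [cost]
    · rw [h0]
      have : μ (3 + w) ≠ r := by omega
      simp [choiceCap, this]
  · simp [cost]

lemma emits_testRow : Emits μ testRow (rowEnv n k u v t (r + 1) [])
    (flat (bundle (t * (k + 1) + (r + 1)) ((t + 1) * (k + 1) + (r + 1))
      (testCaps k n (fun w => μ (3 + w)) (fun u v => μ (3 + n + (u * n + v))) u v r)))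
    (n * 8100 + 30) := by
  refine (((Emits.forLoop rfl (by simp [Below, length_rowEnv]) (show _ = n from rfl) fun i _ =>
    Emits.bind (computes_choice (σ := [i]) rfl (by simp [length_rowEnv]) rfl)
      (emits_rowEdge (σ := [i, _]) (by simp [Below]) rfl)).seq
    (Emits.bind (Computes.sumLoop rfl (by simp [Below, length_rowEnv]) (show _ = n from rfl)
      fun x i _ => computes_choice (σ := [x, i]) rfl (by simp [length_rowEnv]) rfl)
      (emits_rowEdge (σ := [_]) (by simp [Below]) rfl))).mono ?_).of_eq ?_
  · simp [cost]
    omega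
  · rw [testCaps, bundle_append, flat_append, flat_bundle_map_range]
    rfl

end Program

/-! ### Writing whole columns and the complete edge list -/

section Columns

open RAMExpr RAMProgram

variable {μ : ℕ → ℕ} {n k u v t r : ℕ} {σ : List ℕ}

lemma emits_innerColumn (hr : r ≤ k) : Emits μ innerColumn (rowEnv n k u v t r [])
    (flat (bundle (t * (k + 1) + r) (t * (k + 1) + r + 1) (if r = k then [] else [1, 1]))) 28 := by
  refine (Emits.branch (T := 24) (T' := 1) (by simp [Below, length_rowEnv])
    (by simp [Below, length_rowEnv]) ?_ ?_).mono ?_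
  · intro h
    change r < k at h
    rw [if_neg h.ne]
    exact (((emits_columnEdge below_const rfl).seq (emits_columnEdge below_const rfl)).mono
      (by simp [cost])).of_eq rfl
  · intro h
    change ¬ r < k at h
    rw [if_pos (by omega)]
    exact Emits.nop
  · simp [cost]

lemma emits_boundaryColumn (hr : r ≤ k) : Emits μ boundaryColumn (rowEnv n k u v t r [])
    (flat (bundle (t * (k + 1) + r) (t * (k + 1) + r + 1)
      (if r = k then [] else [1, 1] ++ boundaryCaps k n)))
    (2 * (k * (offset k n + n)) * 19 + 40) := by
  refine (Emits.branch (T := 2 * (k * (offset k n + n)) * 19 + 36) (T' := 1)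
    (by simp [Below, length_rowEnv]) (by simp [Below, length_rowEnv]) ?_ ?_).mono ?_
  · intro h
    change r < k at h
    rw [if_neg h.ne, bundle_append, flat_append, boundaryCaps, flat_bundle_replicate]
    refine (((emits_columnEdge below_const rfl).seq ((emits_columnEdge below_const rfl).seq
      (Emits.forLoop rfl (by simp [Below, length_rowEnv])
        (show _ = 2 * (k * (offset k n + n)) from rfl)
        fun i _ => emits_columnEdge (σ := [i]) below_const rfl))).mono ?_).of_eq ?_
    · simp [cost]
      omega
    · have h1 : (const 1).value (rowEnv n k u v t r []) μ = 1 := rfl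
      have h64 : ∀ i, (const 64).value (rowEnv n k u v t r [i]) μ = 64 := fun _ => rfl
      rw [h1]
      simp only [h64]
      simp [flat, bundle]
  · intro h
    change ¬ r < k at h
    rw [if_pos (by omega)]
    exact Emits.nop
  · simp [cost]
    omega

lemma emits_wholeColumn {P Q C : RAMProgram} {h w : ℕ → List ℕ} {T₁ T₂ T₃ : ℕ}
    (hP : Emits μ P (rowEnv n k u v t 0 [])
      (flat (bundle (t * (k + 1) + 0) ((t + 1) * (k + 1) + 0) (h 0))) T₁)
    (hQ : ∀ r < k, Emits μ Q (rowEnv n k u v t (r + 1) [])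
      (flat (bundle (t * (k + 1) + (r + 1)) ((t + 1) * (k + 1) + (r + 1)) (h (r + 1)))) T₂)
    (hC : ∀ r ≤ k, Emits μ C (rowEnv n k u v t r [])
      (flat (bundle (t * (k + 1) + r) (t * (k + 1) + r + 1) (w r))) T₃) :
    Emits μ (wholeColumn P Q C) (columnEnv n k u v t)
      (flat ((List.range (k + 1)).flatMap fun r =>
        bundle (t * (k + 1) + r) ((t + 1) * (k + 1) + r) (h r) ++
          bundle (t * (k + 1) + r) (t * (k + 1) + r + 1) (w r)))
      ((k + 1) * (T₁ + T₂ + T₃ + 12) + 7) := by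
  rw [flat_flatMap]
  refine (Emits.forLoop rfl ?_ (show _ = k + 1 from rfl) (T := T₁ + T₂ + T₃ + 3) fun r hr => ?_).mono
    ?_
  · simp [Below, columnEnv, globalEnv]
  · rw [flat_append]
    refine (Emits.seq (T := T₁ + T₂ + 3) ?_ (hC r (by omega))).mono (by omega)
    refine (Emits.branch (T := T₂) (T' := T₁) below_const
      (by simp [Below, length_rowEnv]) ?_ ?_).mono (by simp [cost]; omega)
    · intro h0
      change 0 < r at h0
      obtain ⟨r, rfl⟩ : ∃ r', r = r' + 1 := ⟨r - 1, by omega⟩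
      exact hQ r (by omega)
    · intro h0
      change ¬ 0 < r at h0
      obtain rfl : r = 0 := by omega
      exact hP
  · have h1 : T₁ + T₂ + T₃ + 3 + (add (reg 1) (const 1)).cost + 6 = T₁ + T₂ + T₃ + 12 := by
      simp [cost]
    rw [h1]
    simp [cost]

/-- The edges that start in column `t` of the reduction. -/
def columnEdges (k n : ℕ) (p : ℕ → ℕ) (a : ℕ → ℕ → ℕ) (t : ℕ) : List (ℕ × ℕ × ℕ) :=
  (List.range (k + 1)).flatMap fun r =>
    bundle (t * (k + 1) + r) ((t + 1) * (k + 1) + r) (rowCaps k n p a t r) ++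
      bundle (t * (k + 1) + r) (t * (k + 1) + r + 1) (columnCaps k n t r)

def boundaryTime (k n : ℕ) : ℕ := 2 * (k * (offset k n + n)) * 19 + 40

/-- The number of steps for a column, up to a constant. -/
def columnTime (k n : ℕ) : ℕ := (k + 1) * (k * n * 21 + n * 8100 + boundaryTime k n + 200) + 7

variable {p : ℕ → ℕ} {a : ℕ → ℕ → ℕ}

lemma emits_firstColumn (hn : 0 < n) :
    Emits μ (wholeColumn returnRow startRow boundaryColumn) (columnEnv n k u v 0)
      (flat (columnEdges k n p a 0)) (columnTime k n) := by
  have h0 : ¬ 0 = n * n + 1 := by omega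
  refine (emits_wholeColumn (h := rowCaps k n p a 0) (w := columnCaps k n 0)
    (T₁ := k * n * 21 + 47) (T₂ := n * 21 + 19) (T₃ := boundaryTime k n) ?_ ?_ ?_).mono ?_
  · rw [rowCaps, if_neg h0, if_pos rfl]
    exact emits_returnRow
  · intro r hr
    rw [rowCaps, if_neg h0, if_neg (by omega), if_pos rfl]
    exact emits_startRow
  · intro r hr
    rw [columnCaps, if_pos (c := _ ∨ _) (.inl rfl)]
    exact emits_boundaryColumn hr
  · exact Nat.add_le_add_right (Nat.mul_le_mul_left _ (by omega)) _

lemma emits_middleColumn (hu : u < n) (hv : v < n) (hp : p = fun w => μ (3 + w))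
    (ha : a = fun u v => μ (3 + n + (u * n + v))) :
    Emits μ (wholeColumn returnRow testRow innerColumn) (columnEnv n k u v (u * n + v + 1))
      (flat (columnEdges k n p a (u * n + v + 1))) (columnTime k n) := by
  have ht : u * n + v < n * n := by nlinarith
  have hdiv : (u * n + v) / n = u := by
    rw [Nat.add_comm, Nat.add_mul_div_right _ _ (by omega), Nat.div_eq_of_lt hv, Nat.zero_add]
  have hmod : (u * n + v) % n = v := by
    rw [Nat.add_comm, Nat.add_mul_mod_self_right, Nat.mod_eq_of_lt hv]
  refine (emits_wholeColumn (h := rowCaps k n p a (u * n + v + 1))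
    (w := columnCaps k n (u * n + v + 1))
    (T₁ := k * n * 21 + 47) (T₂ := n * 8100 + 30) (T₃ := 28) ?_ ?_ ?_).mono ?_
  · rw [rowCaps, if_neg (by omega), if_pos rfl]
    exact emits_returnRow
  · intro r hr
    rw [rowCaps, if_neg (by omega), if_neg (by omega), if_neg (by omega), Nat.add_sub_cancel,
      Nat.add_sub_cancel, hdiv, hmod, hp, ha]
    exact emits_testRow
  · intro r hr
    rw [columnCaps, if_neg (c := _ ∨ _) (by omega), List.append_nil]
    exact emits_innerColumn hr
  · exact Nat.add_le_add_right (Nat.mul_le_mul_left _ (by omega)) _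

lemma emits_lastColumn :
    Emits μ (wholeColumn .nop .nop boundaryColumn) (columnEnv n k u v (n * n + 1))
      (flat (columnEdges k n p a (n * n + 1))) (columnTime k n) := by
  have h0 : ∀ r, rowCaps k n p a (n * n + 1) r = [] := fun r => if_pos rfl
  refine (emits_wholeColumn (h := rowCaps k n p a (n * n + 1)) (w := columnCaps k n (n * n + 1))
    (T₁ := 1) (T₂ := 1) (T₃ := boundaryTime k n) ?_ ?_ ?_).mono ?_
  · rw [h0]
    exact Emits.nop
  · intro r hr
    rw [h0]
    exact Emits.nop
  · intro r hr
    rw [columnCaps, if_pos (c := _ ∨ _) (.inr rfl)]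
    exact emits_boundaryColumn hr
  · exact Nat.add_le_add_right (Nat.mul_le_mul_left _ (by omega)) _

lemma range_mul_flatMap {α : Type*} (m n : ℕ) (f : ℕ → List α) :
    (List.range (m * n)).flatMap f =
      (List.range m).flatMap fun u => (List.range n).flatMap fun v => f (u * n + v) := by
  induction m with
  | zero => simp
  | succ m ih =>
    rw [Nat.succ_mul, List.range_add, List.flatMap_append, ih, List.range_succ,
      List.flatMap_append, List.flatMap_map]
    simp

lemma flat_reductionEdges : flat (reductionEdges k n p a) =
    flat (columnEdges k n p a 0) ++ (((List.range n).flatMap fun u => (List.range n).flatMap fun v =>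
      flat (columnEdges k n p a (u * n + v + 1))) ++ flat (columnEdges k n p a (n * n + 1))) := by
  rw [← range_mul_flatMap n n fun t => flat (columnEdges k n p a (t + 1))]
  have h : reductionEdges k n p a = (List.range (n * n + 1 + 1)).flatMap (columnEdges k n p a) :=
    rfl
  rw [h, flat_flatMap, List.range_succ, List.range_succ_eq_map]
  simp [List.flatMap_map]

/-- The outer columns test no pair; dummy zeros give them the register layout of the middle ones. -/
lemma Emits.withRegisters {Q : RAMProgram} {L : List ℕ} {T : ℕ}
    (h : Emits μ Q (globalEnv n k ++ [0] ++ [0 * n] ++ [0]) L T) :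
    Emits μ (RAMProgram.withRegisters Q) (globalEnv n k) L (T + 6) := by
  refine (Emits.bind (Computes.assign rfl below_const) (Emits.bind
    ((Computes.assign rfl below_const).of_eq (Nat.zero_mul n).symm) (Emits.bind
    (Computes.assign rfl below_const) h))).mono ?_
  simp [cost]
  omega

def middleTime (k n : ℕ) : ℕ :=
  n * (n * 13 + 7 + (n * ((k + 1) * 19 + 9 + columnTime k n + 7) + 5) + 7) + 5

lemma emits_middleColumns (hp : p = fun w => μ (3 + w))
    (ha : a = fun u v => μ (3 + n + (u * n + v))) :
    Emits μ middleColumns (globalEnv n k)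
      ((List.range n).flatMap fun u => (List.range n).flatMap fun v =>
        flat (columnEdges k n p a (u * n + v + 1))) (middleTime k n) := by
  refine (Emits.forLoop (T := n * 13 + 7 + (n * ((k + 1) * 19 + 9 + columnTime k n + 7) + 5)) rfl
    (by simp [Below, globalEnv]) (show _ = n from rfl) fun u hu =>
    Emits.bind (v := u * n) (Computes.mul_of_eq rfl (by simp [Below, globalEnv])
      (by simp [Below, globalEnv]) (x := n) (y := u) (by rfl) (by rfl) (Nat.mul_comm n u)
      (by simp only [cost]; omega)) ?_).mono le_rfl
  refine (Emits.forLoop (T := (k + 1) * 19 + 9 + columnTime k n) rfl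
    (by simp [Below, globalEnv]) (show _ = n from rfl) fun v hv =>
    Emits.bind (v := (u * n + v + 1) * (k + 1)) (Computes.mul_of_eq rfl
      (by simp [Below, globalEnv]) (by simp [Below, globalEnv]) (x := k + 1)
      (y := u * n + v + 1) (by rfl) (by rfl)
      (Nat.mul_comm (k + 1) (u * n + v + 1)) (by simp only [cost]; omega))
      (emits_middleColumn hu hv hp ha)).mono le_rfl

lemma value_times64 {ρ : List ℕ} {e : RAMExpr} {x : ℕ} (h : e.value ρ μ = x) :
    (times64 e).value ρ μ = 64 * x := by
  have hd : ∀ e : RAMExpr, (double e).value ρ μ = e.value ρ μ + e.value ρ μ := fun _ => rfl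
  rw [times64, hd, hd, hd, hd, hd, hd, h]
  ring

def mainTime (k n : ℕ) : ℕ :=
  (k + 1) * 100 + n * 13 + 1000 + 2 * columnTime k n + middleTime k n

lemma emits_mainPart (hn : 0 < n) (hp : p = fun w => μ (3 + w))
    (ha : a = fun u v => μ (3 + n + (u * n + v))) :
    Emits μ mainPart [n, k] ((n * n + 2) * (k + 1) :: flat (reductionEdges k n p a))
      (mainTime k n) := by
  have h3 : (times64 (add (double (add (reg 2) (const 1))) (reg 0))).value [n, k, k * n] μ =
      64 * (2 * offset k n + n) := by
    refine value_times64 ?_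
    change (k * n + 1) + (k * n + 1) + n = _
    unfold offset
    ring
  have h5 : k * (offset k n + n + (offset k n + n)) = 2 * (k * (offset k n + n)) := by ring
  rw [flat_reductionEdges]
  -- After each computation, the remaining budget is `mainTime k n` minus the steps already charged.
  refine (Emits.bind (T := k * 13 + 7) (Computes.mul_of_eq rfl (by simp [Below]) (by simp [Below])
    (x := k) (y := n) (by rfl) (by rfl) rfl
    (by simp only [cost]; omega)) ?_).mono (T := k * 13 + 7 + (mainTime k n - (k * 13 + 7)))
    (by unfold mainTime; omega)
  refine (Emits.bind (T := 640) ((Computes.assign rfl (by simp [Below, times64, double])).of_eq h3)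
    ?_).mono (T := 640 + (mainTime k n - (k * 13 + 647))) (by unfold mainTime; omega)
  refine (Emits.bind (T := k * 13 + 7) (Computes.mul_of_eq rfl (by simp [Below]) (by simp [Below])
    (x := k) (y := 64 * (2 * offset k n + n)) (by rfl) (by rfl) rfl
    (by simp only [cost]; omega)) ?_).mono (T := k * 13 + 7 + (mainTime k n - (k * 26 + 654)))
    (by unfold mainTime; omega)
  refine (Emits.bind (T := k * 23 + 7) (Computes.mul_of_eq rfl (by simp [Below])
    (by simp [Below, double]) (x := k) (y := offset k n + n + (offset k n + n)) (by rfl) (by rfl) h5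
    (by simp only [cost, double]; omega)) ?_).mono
    (T := k * 23 + 7 + (mainTime k n - (k * 49 + 661))) (by unfold mainTime; omega)
  refine (Emits.bind (T := n * 13 + 7) (Computes.mul_of_eq rfl (by simp [Below]) (by simp [Below])
    (x := n) (y := n) (by rfl) (by rfl) rfl
    (by simp only [cost]; omega)) ?_).mono
    (T := n * 13 + 7 + (mainTime k n - (k * 49 + n * 13 + 668)))
    (by unfold mainTime; omega)
  refine (Emits.bind (T := (k + 1) * 17 + 9) (Computes.mul_of_eq rfl (by simp [Below])
    (by simp [Below]) (x := k + 1) (y := n * n + 2) (by rfl) (by rfl)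
    (Nat.mul_comm (k + 1) (n * n + 2))
    (by simp only [cost]; omega))
    (T' := 2 + (columnTime k n + 8 + (middleTime k n + ((k + 1) * 17 + 9 + columnTime k n + 6))))
    ?_).mono (by unfold mainTime; omega)
  refine (Emits.write (by simp [Below])).seq ?_
  refine ((Emits.withRegisters (Emits.bind
    ((Computes.assign rfl below_const).of_eq (Nat.zero_mul (k + 1)).symm)
    (emits_firstColumn (u := 0) (v := 0) hn))).mono (by simp [cost]; omega)).seq ?_
  refine (emits_middleColumns hp ha).seq ?_
  exact Emits.withRegisters (Emits.bind
    (Computes.mul_of_eq rfl (by simp [Below, globalEnv]) (by simp [Below, globalEnv]) (x := k + 1)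
      (y := n * n + 1) (by rfl) (by rfl) (Nat.mul_comm (k + 1) (n * n + 1))
      (by simp only [cost]; omega)) (emits_lastColumn (u := 0) (v := 0)))

end Columns

/-! ### The reduction -/

lemma mem_bundle {x y : ℕ} {l : List ℕ} {e : ℕ × ℕ × ℕ} :
    e ∈ bundle x y l ↔ e.1 = x ∧ e.2.1 = y ∧ e.2.2 ∈ l := by
  obtain ⟨e1, e2, e3⟩ := e
  simp only [bundle, List.mem_map, Prod.mk.injEq]
  constructor
  · rintro ⟨c, hc, rfl, rfl, rfl⟩
    exact ⟨rfl, rfl, hc⟩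
  · rintro ⟨rfl, rfl, hc⟩
    exact ⟨e3, hc, rfl, rfl, rfl⟩

/-- The edge joins two neighbours of a grid with columns of `R` vertices. -/
def IsGridEdge (R : ℕ) (e : ℕ × ℕ × ℕ) : Prop :=
  e.2.1 = e.1 + R ∨ (e.2.1 = e.1 + 1 ∧ e.1 % R + 1 < R)

/-- Quotient and remainder by `R` are the column and the row. The second condition in `IsGridEdge`
excludes a step from the top of a column to the next one. -/
lemma isPlanar_ofList {n R : ℕ} (hR : 0 < R) {L : List (ℕ × ℕ × ℕ)}
    (hL : ∀ e ∈ L, e.1 < n ∧ e.2.1 < n ∧ e.1 ≠ e.2.1) (hg : ∀ e ∈ L, IsGridEdge R e) :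
    (Multigraph.ofList n L hL).IsPlanar := by
  refine Multigraph.isPlanar_of_grid _ (fun v => ((v : ℕ) / R, (v : ℕ) % R)) ?_ ?_
  · intro v w h
    simp only [Prod.mk.injEq] at h
    have h1 := Nat.div_add_mod (v : ℕ) R
    rw [h.1, h.2, Nat.div_add_mod] at h1
    exact Fin.ext h1.symm
  · intro e
    change ((L.get e).2.1 / R, (L.get e).2.1 % R) = ((L.get e).1 / R + 1, (L.get e).1 % R) ∨
      ((L.get e).2.1 / R, (L.get e).2.1 % R) = ((L.get e).1 / R, (L.get e).1 % R + 1)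
    rcases hg _ (L.get_mem e) with h | ⟨h, h'⟩
    · left
      rw [h, Nat.add_div_right _ hR, Nat.add_mod_right]
    · right
      have h1 := Nat.div_add_mod (L.get e).1 R
      have h2 : (L.get e).2.1 = ((L.get e).1 % R + 1) + R * ((L.get e).1 / R) := by omega
      rw [h2, Nat.add_mul_div_left _ _ hR, Nat.div_eq_of_lt h', Nat.add_mul_mod_self_left,
        Nat.mod_eq_of_lt h', Nat.zero_add]

lemma pathwidth_ofList_le {n w : ℕ} {L : List (ℕ × ℕ × ℕ)}
    (hL : ∀ e ∈ L, e.1 < n ∧ e.2.1 < n ∧ e.1 ≠ e.2.1)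
    (hw : ∀ e ∈ L, e.1 ≤ e.2.1 ∧ e.2.1 ≤ e.1 + w) :
    (Multigraph.ofList n L hL).pathwidth ≤ w := by
  refine Multigraph.pathwidth_le_of_bandwidth _ w fun e => ?_
  obtain ⟨h1, h2⟩ := hw _ (L.get_mem e)
  exact ⟨h1.trans (Nat.le_add_right _ _), h2⟩

section

variable {k n : ℕ} {p : ℕ → ℕ} {a : ℕ → ℕ → ℕ}

lemma mem_reductionEdges {e : ℕ × ℕ × ℕ} (he : e ∈ reductionEdges k n p a) :
    ∃ t r, r ≤ k ∧
      ((t ≤ n * n ∧ e.1 = t * (k + 1) + r ∧ e.2.1 = (t + 1) * (k + 1) + r ∧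
        e.2.2 ∈ rowCaps k n p a t r) ∨
      (t ≤ n * n + 1 ∧ r < k ∧ e.1 = t * (k + 1) + r ∧ e.2.1 = t * (k + 1) + r + 1 ∧
        e.2.2 ∈ columnCaps k n t r)) := by
  simp only [reductionEdges, gridEdges, List.mem_flatMap, List.mem_range, List.mem_append,
    mem_bundle] at he
  obtain ⟨t, ht, r, hr, ⟨h1, h2, h3⟩ | ⟨h1, h2, h3⟩⟩ := he
  · refine ⟨t, r, by omega, .inl ⟨?_, h1, h2, h3⟩⟩
    by_contra hc
    rw [rowCaps, if_pos (by omega)] at h3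
    simp at h3
  · refine ⟨t, r, by omega, .inr ⟨by omega, ?_, h1, h2, h3⟩⟩
    by_contra hc
    rw [columnCaps, if_pos (by omega)] at h3
    simp at h3

lemma reductionEdges_spec {e : ℕ × ℕ × ℕ} (he : e ∈ reductionEdges k n p a) :
    (e.1 < (n * n + 2) * (k + 1) ∧ e.2.1 < (n * n + 2) * (k + 1) ∧ e.1 ≠ e.2.1) ∧
      IsGridEdge (k + 1) e ∧ e.1 ≤ e.2.1 ∧ e.2.1 ≤ e.1 + (k + 1) := by
  obtain ⟨t, r, hr, ⟨ht, h1, h2, -⟩ | ⟨ht, hr', h1, h2, -⟩⟩ := mem_reductionEdges he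
  · have h3 : (t + 1 + 1) * (k + 1) ≤ (n * n + 2) * (k + 1) :=
      Nat.mul_le_mul_right _ (by omega)
    have h4 : (t + 1) * (k + 1) = t * (k + 1) + (k + 1) := Nat.succ_mul _ _
    have h5 : (t + 1 + 1) * (k + 1) = (t + 1) * (k + 1) + (k + 1) := Nat.succ_mul _ _
    exact ⟨⟨by omega, by omega, by omega⟩, .inl (by omega), by omega, by omega⟩
  · have h3 : (t + 1) * (k + 1) ≤ (n * n + 2) * (k + 1) := Nat.mul_le_mul_right _ (by omega)
    have h4 : (t + 1) * (k + 1) = t * (k + 1) + (k + 1) := Nat.succ_mul _ _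
    refine ⟨⟨by omega, by omega, by omega⟩, .inr ⟨by omega, ?_⟩, by omega, by omega⟩
    rw [h1, Nat.add_comm (t * (k + 1)) r, Nat.add_mul_mod_self_right, Nat.mod_eq_of_lt (by omega)]
    omega

/-- The largest capacities are the offset of the returning row and the total of the choices in a
test row; `k` is estimated by `n`. -/
def capBound (n : ℕ) : ℕ := 64 * (n * (2 * (n * n + 1) + 2 * n)) + 64

lemma reductionEdges_cap_le (hn : 0 < n) (hk : k ≤ n) {e : ℕ × ℕ × ℕ}
    (he : e ∈ reductionEdges k n p a) : e.2.2 ≤ capBound n := by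
  have hM : offset k n ≤ n * n + 1 := Nat.succ_le_succ (Nat.mul_le_mul_right _ hk)
  have h1 : 2 * offset k n + 2 * n ≤ n * (2 * (n * n + 1) + 2 * n) :=
    calc 2 * offset k n + 2 * n ≤ 1 * (2 * (n * n + 1) + 2 * n) := by omega
      _ ≤ _ := Nat.mul_le_mul_right _ hn
  have h64 : 64 ≤ capBound n := Nat.le_add_left _ _
  have hc : ∀ u v c w, w < n → choiceCap k n p a u v c w ≤ 64 * (offset k n + n) := by
    intro u v c w hw
    unfold choiceCap
    split_ifs <;> omega
  obtain ⟨t, r, hr, ⟨ht, -, -, h⟩ | ⟨ht, hr', -, -, h⟩⟩ := mem_reductionEdges he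
  · unfold rowCaps at h
    split_ifs at h
    · simp at h
    · simp only [returnCaps, List.mem_append, List.mem_cons, List.mem_replicate, List.not_mem_nil,
        or_false] at h
      rcases h with h | ⟨-, h⟩ | h | h
      · have h2 : k * (2 * offset k n + n) ≤ n * (2 * (n * n + 1) + 2 * n) :=
          Nat.mul_le_mul hk (by omega)
        unfold capBound
        omega
      all_goals omega
    · simp only [startCaps, List.mem_append, List.mem_cons, List.mem_replicate, List.not_mem_nil,
        or_false] at h
      rcases h with h | ⟨-, h⟩
      · unfold capBound
        omega
      · omega
    · simp only [testCaps, List.mem_append, List.mem_cons, List.mem_map, List.mem_range,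
        List.not_mem_nil, or_false] at h
      rcases h with ⟨w, hw, h⟩ | h
      · have := hc ((t - 1) / n) ((t - 1) % n) (r - 1) w hw
        unfold capBound
        omega
      · have h2 := Finset.sum_le_card_nsmul (Finset.range n) _ _ fun w hw =>
          hc ((t - 1) / n) ((t - 1) % n) (r - 1) w (Finset.mem_range.1 hw)
        rw [Finset.card_range, smul_eq_mul] at h2
        have h3 : n * (64 * (offset k n + n)) ≤ n * (64 * (2 * (n * n + 1) + 2 * n)) :=
          Nat.mul_le_mul_left _ (by omega)
        have h4 : n * (64 * (2 * (n * n + 1) + 2 * n)) = 64 * (n * (2 * (n * n + 1) + 2 * n)) := by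
          ring
        unfold capBound
        omega
  · simp only [columnCaps, boundaryCaps] at h
    split_ifs at h
    · simp at h
    · simp only [List.mem_append, List.mem_cons, List.mem_replicate, List.not_mem_nil,
        or_false] at h
      omega
    · simp only [List.append_nil, List.mem_cons, List.not_mem_nil, or_false] at h
      omega

/-- The number of vertices of the constructed graph. -/
def vertexCount (k n : ℕ) : ℕ :=
  if n = 0 then if k = 0 then 0 else 2 else (n * n + 2) * (k + 1)

/-- The edges of the constructed graph, including the case that there are no vertices. -/
def allEdges (k n : ℕ) (p : ℕ → ℕ) (a : ℕ → ℕ → ℕ) : List (ℕ × ℕ × ℕ) :=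
  if n = 0 then if k = 0 then [] else [(0, 1, 1)] else reductionEdges k n p a

lemma allEdges_valid : ∀ e ∈ allEdges k n p a,
    e.1 < vertexCount k n ∧ e.2.1 < vertexCount k n ∧ e.1 ≠ e.2.1 := by
  intro e he
  unfold allEdges at he
  unfold vertexCount
  split_ifs at he ⊢
  · simp at he
  · simp at he
    simp [he]
  · exact (reductionEdges_spec he).1

end

/-! ### The reduction on instances and its properties -/

namespace MulticoloredClique

variable (I : MulticoloredClique)

/-- The class of a vertex, as written in the encoding. -/
noncomputable def classOf (w : ℕ) : ℕ := I.encode.getD (3 + w) 0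

/-- An entry of the adjacency matrix, as written in the encoding. -/
noncomputable def entry (u v : ℕ) : ℕ := I.encode.getD (3 + I.n + (u * I.n + v)) 0

noncomputable def toCirculatingOrientation : CirculatingOrientation :=
  CirculatingOrientation.ofList (vertexCount I.k I.n) (allEdges I.k I.n I.classOf I.entry)
    allEdges_valid

lemma getD_flatten {m v : ℕ} (hv : v < m) (l : List (List ℕ)) (hl : ∀ x ∈ l, x.length = m)
    (u : ℕ) : l.flatten.getD (u * m + v) 0 = (l.getD u []).getD v 0 := by
  induction l generalizing u with
  | nil => simp
  | cons x l ih =>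
    have hx := hl x (by simp)
    rw [List.flatten_cons]
    cases u with
    | zero =>
      rw [List.getD_append _ _ _ _ (by omega)]
      simp
    | succ u =>
      rw [List.getD_append_right _ _ _ _ (by rw [hx, Nat.succ_mul]; omega), hx,
        show (u + 1) * m + v - m = u * m + v by rw [Nat.succ_mul]; omega,
        ih fun y hy => hl y (by simp [hy])]
      simp

lemma classOf_eq (v : Fin I.n) : I.classOf v = I.part v := by
  unfold classOf encode
  rw [List.append_assoc, List.getD_append_right _ _ _ _ (by simp),
    List.getD_append _ _ _ _ (by simp)]
  simp

lemma entry_ne_zero_iff (u v : Fin I.n) : I.entry u v ≠ 0 ↔ I.graph.Adj u v := by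
  classical
  unfold entry encode
  rw [List.getD_append_right _ _ _ _ (by simp; omega)]
  simp only [List.length_append, List.length_cons, List.length_nil, List.length_ofFn]
  rw [show 3 + I.n + ((u : ℕ) * I.n + v) - (0 + 1 + 1 + 1 + I.n) = u * I.n + v by omega,
    getD_flatten v.2]
  · simp
  · intro x hx
    rw [List.mem_ofFn] at hx
    obtain ⟨w, rfl⟩ := hx
    simp

/-- A set with one vertex in each class is the image of a choice function. Vertices chosen in
distinct classes are distinct, so being a clique means that they are pairwise adjacent. -/
lemma isYes_iff : I.IsYes ↔ ∃ x : ℕ → ℕ, (∀ c < I.k, x c < I.n ∧ I.classOf (x c) = c) ∧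
    ∀ c < I.k, ∀ c' < I.k, c ≠ c' → I.entry (x c) (x c') ≠ 0 := by
  constructor
  · rintro ⟨C, hC, h⟩
    have h1 : ∀ i : Fin I.k, ∃ v ∈ C, I.part v = i := by
      intro i
      obtain ⟨v, hv⟩ := Finset.card_pos.1 (by rw [h i]; exact one_pos)
      exact ⟨v, (Finset.mem_filter.1 hv).1, (Finset.mem_filter.1 hv).2⟩
    choose x hx hp using h1
    refine ⟨fun c => if hc : c < I.k then x ⟨c, hc⟩ else 0, fun c hc => ?_,
      fun c hc c' hc' hne => ?_⟩
    · simp only [hc, dif_pos]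
      exact ⟨(x ⟨c, hc⟩).2, by rw [classOf_eq, hp]⟩
    · simp only [hc, hc', dif_pos]
      rw [entry_ne_zero_iff]
      refine hC (hx _) (hx _) fun he => hne ?_
      have := congrArg I.part he
      rw [hp, hp] at this
      exact congrArg Fin.val this
  · rintro ⟨x, hx, hadj⟩
    let y : Fin I.k → Fin I.n := fun i => ⟨x i, (hx i i.2).1⟩
    have hy : ∀ i, I.part (y i) = i := fun i =>
      Fin.ext ((I.classOf_eq (y i)).symm.trans (hx i i.2).2)
    refine ⟨Finset.univ.image y, ?_, fun i => ?_⟩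
    · intro v hv w hw hne
      simp only [Finset.coe_image, Finset.coe_univ, Set.image_univ, Set.mem_range] at hv hw
      obtain ⟨i, rfl⟩ := hv
      obtain ⟨j, rfl⟩ := hw
      rw [← entry_ne_zero_iff]
      refine hadj i i.2 j j.2 fun h => hne ?_
      rw [Fin.ext h]
    · rw [Finset.card_eq_one]
      refine ⟨y i, ?_⟩
      ext v
      simp only [Finset.mem_filter, Finset.mem_image, Finset.mem_univ, true_and,
        Finset.mem_singleton]
      constructor
      · rintro ⟨⟨j, rfl⟩, h⟩
        rw [hy] at h
        rw [h]
      · rintro rfl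
        exact ⟨⟨i, rfl⟩, hy i⟩

/-- Equal class sizes give `k ≤ n` as soon as there is a vertex, which makes all bounds depend on
`n` alone. -/
lemma n_eq : I.n = I.k * I.N := by
  have h := Finset.card_eq_sum_card_fiberwise (f := I.part) (s := Finset.univ)
    (t := Finset.univ) (fun _ _ => Finset.mem_coe.2 (Finset.mem_univ _))
  simpa [I.card_part] using h

lemma k_pos (hn : 0 < I.n) : 0 < I.k := by
  rw [n_eq] at hn
  exact Nat.pos_of_mul_pos_right hn

lemma k_le (hn : 0 < I.n) : I.k ≤ I.n := by
  rw [n_eq] at hn ⊢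
  exact Nat.le_mul_of_pos_right _ (Nat.pos_of_mul_pos_left hn)

theorem isYes_toCirculatingOrientation : I.IsYes ↔ I.toCirculatingOrientation.IsYes := by
  rw [isYes_iff, toCirculatingOrientation, CirculatingOrientation.isYes_ofList]
  unfold allEdges
  rcases Nat.eq_zero_or_pos I.n with hn | hn
  · rw [if_pos hn]
    split_ifs with hk
    · simp [hk, Orientable]
    · constructor
      · rintro ⟨x, hx, -⟩
        have := (hx 0 (by omega)).1
        omega
      -- The single edge has capacity 1, so the excess at vertex `1` would be nonzero.
      · intro h
        exfalso
        rcases h with h | h <;>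
        · have h1 := congrFun h 1
          simp [unitFlow] at h1
  · rw [if_neg hn.ne', orientable_reductionEdges (I.k_pos hn) hn]

theorem isPlanar_toCirculatingOrientation : I.toCirculatingOrientation.graph.IsPlanar := by
  rcases Nat.eq_zero_or_pos I.n with hn | hn
  · refine isPlanar_ofList (R := 1) one_pos allEdges_valid fun e he => ?_
    unfold allEdges at he
    rw [if_pos hn] at he
    split_ifs at he
    · simp at he
    · simp at he
      subst he
      exact .inl rfl
  · refine isPlanar_ofList (R := I.k + 1) (Nat.succ_pos _) allEdges_valid fun e he => ?_
    rw [allEdges, if_neg hn.ne'] at he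
    exact (reductionEdges_spec he).2.1

theorem pathwidth_toCirculatingOrientation_le :
    I.toCirculatingOrientation.graph.pathwidth ≤ 2 * I.k := by
  refine pathwidth_ofList_le allEdges_valid fun e he => ?_
  unfold allEdges at he
  split_ifs at he with hn hk
  · simp at he
  · simp at he
    subst he
    simp
    omega
  · obtain ⟨-, -, h1, h2⟩ := reductionEdges_spec he
    -- As `k ≥ 1`, the bandwidth `k + 1` is at most `2 * k`.
    have := I.k_pos (by omega)
    exact ⟨h1, by omega⟩

theorem cap_toCirculatingOrientation_le (e : Fin I.toCirculatingOrientation.m) :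
    I.toCirculatingOrientation.cap e ≤ capBound I.n := by
  have he := (allEdges I.k I.n I.classOf I.entry).get_mem e
  change ((allEdges I.k I.n I.classOf I.entry).get e).2.2 ≤ _
  generalize (allEdges I.k I.n I.classOf I.entry).get e = e' at he ⊢
  unfold allEdges at he
  split_ifs at he with hn hk
  · simp at he
  · simp at he
    subst he
    exact (show 1 ≤ 64 by norm_num).trans (Nat.le_add_left _ _)
  · exact reductionEdges_cap_le (by omega) (I.k_le (by omega)) he

lemma encode_ofList {m : ℕ} {L : List (ℕ × ℕ × ℕ)}
    (hL : ∀ e ∈ L, e.1 < m ∧ e.2.1 < m ∧ e.1 ≠ e.2.1) :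
    (CirculatingOrientation.ofList m L hL).encode = m :: flat L := by
  have h : (List.ofFn fun e : Fin L.length => [(L.get e).1, (L.get e).2.1, (L.get e).2.2]) =
      L.map fun e => [e.1, e.2.1, e.2.2] := by
    conv_rhs => rw [← List.ofFn_get L, List.map_ofFn]
    rfl
  change m :: (List.ofFn fun e : Fin L.length =>
    [(L.get e).1, (L.get e).2.1, (L.get e).2.2]).flatten = _
  rw [h, flat, List.flatMap_def]

/-- The encoding lists a class for every vertex, and each number counts at least one for its
separator. -/
lemma n_le_inputSize : I.n ≤ inputSize I.encode := by
  have h1 : ∀ l : List ℕ, l.length ≤ inputSize l := by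
    intro l
    unfold inputSize
    induction l with
    | nil => simp
    | cons x l ih =>
      simp only [List.map_cons, List.sum_cons, List.length_cons]
      omega
  refine le_trans ?_ (h1 I.encode)
  unfold encode
  simp only [List.length_append, List.length_ofFn]
  omega

lemma emits_reduction : Emits (fun i => I.encode.getD i 0) RAMProgram.reduction []
    I.toCirculatingOrientation.encode (mainTime I.n I.n + 30) := by
  rw [toCirculatingOrientation, encode_ofList]
  have hc2 : Computes (fun i => I.encode.getD i 0) (.assign 0 (.mem (.const 2))) [] I.n 3 :=
    Computes.assign rfl trivial
  have hc0 : Computes (fun i => I.encode.getD i 0) (.assign 1 (.mem (.const 0))) [I.n] I.k 3 :=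
    Computes.assign rfl trivial
  refine (Emits.bind hc2 (Emits.bind hc0 (T' := mainTime I.n I.n + 24) ?_)).mono (by omega)
  unfold vertexCount allEdges
  rcases Nat.eq_zero_or_pos I.n with hn | hn
  · rw [if_pos hn, if_pos hn]
    refine (Emits.branch (T := 0) (T' := 21) below_const (by simp [RAMExpr.Below])
      (fun h => ?_) fun _ => ?_).mono (by simp only [RAMExpr.cost]; omega)
    · change 0 < I.n at h
      omega
    refine (Emits.branch (T := 8) (T' := 2) below_const (by simp [RAMExpr.Below]) ?_ ?_).mono
      (by simp [RAMExpr.cost])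
    · intro h
      change 0 < I.k at h
      rw [if_neg h.ne', if_neg h.ne']
      exact (((Emits.write below_const).seq (Emits.writeEdge below_const below_const
        below_const)).mono (by simp [RAMExpr.cost])).of_eq rfl
    · intro h
      change ¬ 0 < I.k at h
      rw [if_pos (by omega), if_pos (by omega)]
      exact (Emits.write below_const).of_eq rfl
  · rw [if_neg hn.ne', if_neg hn.ne']
    refine (Emits.branch (T := mainTime I.k I.n) (T' := 0) below_const (by simp [RAMExpr.Below])
      (fun _ => emits_mainPart hn rfl rfl) fun h => absurd hn ?_).mono ?_
    · exact h
    have := I.k_le hn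
    -- The time bound is monotone, so `k ≤ n` removes `k` from it.
    have h3 : mainTime I.k I.n ≤ mainTime I.n I.n := by
      unfold mainTime middleTime columnTime boundaryTime offset
      gcongr
    simp only [RAMExpr.cost]
    omega

open Polynomial in
lemma exists_polynomial_mainTime : ∃ P : ℕ[X], ∀ n, mainTime n n + 30 = P.eval n := by
  let off : ℕ[X] := X * X + 1
  let bt : ℕ[X] := 2 * (X * (off + X)) * 19 + 40
  let ct : ℕ[X] := (X + 1) * (X * X * 21 + X * 8100 + bt + 200) + 7
  let mt : ℕ[X] := X * (X * 13 + 7 + (X * ((X + 1) * 19 + 9 + ct + 7) + 5) + 7) + 5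
  refine ⟨(X + 1) * 100 + X * 13 + 1000 + 2 * ct + mt + 30, fun n => ?_⟩
  simp [off, bt, ct, mt, mainTime, middleTime, columnTime, boundaryTime, offset]

theorem polyTimeComputable_toCirculatingOrientation :
    PolyTimeComputable encode CirculatingOrientation.encode toCirculatingOrientation := by
  obtain ⟨P, hP⟩ := exists_polynomial_mainTime
  refine ⟨RAMProgram.reduction, P, fun I => ?_⟩
  obtain ⟨t, s, h1, h2, -, h3⟩ := I.emits_reduction (RAMState.init I.encode)
    ⟨fun i hi => absurd hi (by simp), rfl⟩
  refine ⟨t, s, h1, h3, h2.trans ?_⟩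
  rw [← hP]
  have := I.n_le_inputSize
  unfold mainTime middleTime columnTime boundaryTime offset
  gcongr

end MulticoloredClique

theorem mainTheorem3 :
    ∃ f : MulticoloredClique → CirculatingOrientation,
      PolyTimeComputable MulticoloredClique.encode CirculatingOrientation.encode f ∧
      (∀ I, I.IsYes ↔ (f I).IsYes) ∧
      (∀ I, (f I).graph.IsPlanar) ∧
      (∃ C : ℕ, ∀ I, (f I).graph.pathwidth ≤ C * I.k) ∧
      (∃ q : Polynomial ℕ, ∀ I, ∀ e, (f I).cap e ≤ q.eval I.n) := by
  refine ⟨MulticoloredClique.toCirculatingOrientation,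
    MulticoloredClique.polyTimeComputable_toCirculatingOrientation,
    MulticoloredClique.isYes_toCirculatingOrientation,
    MulticoloredClique.isPlanar_toCirculatingOrientation,
    ⟨2, MulticoloredClique.pathwidth_toCirculatingOrientation_le⟩,
    ⟨64 * (.X * (2 * (.X * .X + 1) + 2 * .X)) + 64, fun I e => ?_⟩⟩
  refine (I.cap_toCirculatingOrientation_le e).trans (le_of_eq ?_)
  simp [capBound]
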